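/- **Setting.** A dual quaternion is $q=q_{\mathrm{st}}+q_{\mathcal I}\epsilon$ with $q_{\mathrm{st}},q_{\mathcal I}$ real quaternions, $\epsilon^2=0$, $\epsilon$ central, and $q^*=q_{\mathrm{st}}^*+q_{\mathcal I}^*\epsilon$; it is a dual number if both parts are real, and appreciable if $q_{\mathrm{st}}\ne 0$. A vector is appreciable if its standard part is nonzero; $\|x\|_2=\sqrt{x^*x}$ (a dual number) for appreciable $x$, and $\|x_{\mathcal I}\epsilon\|_2=\|x_{\mathcal I}\|\epsilon$. A right eigenpair $(\mu,x)$ of $A$ has $x$ appreciable and $Ax=x\mu$. *Rayleigh quotient iteration (RQI)* for a matrix $B$ from $u_0$ with $\|u_0\|_2=1$ (exact arithmetic, zero tolerance, no bound on the number of steps): put $\theta_k=u_k^*Bu_k$. If $B-\theta_kI$ is singular, solve $(B-\theta_kI)x=0$ for a unit vector $x$ and return $(\theta_k,x)$. Otherwise solve $(B-\theta_kI)w=u_k$ and put $u_{k+1}=w/\|w\|_2$. If this never stops, RQI returns $(\mu,x)$ when $\theta_k\to\mu$ and $s_ku_k\to x$ for some signs $s_k=\pm1$. (In all remaining cases RQI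 returns nothing.) *Deflation procedure* for $A$ with tolerance $\gamma$: $\hat A_1=A$. In round $k=1,2,\dots$, RQI for $\hat A_k$, from some unit starting vector, returns $(\lambda_k,u_k)$; set $\hat A_{k+1}=\hat A_k-\lambda_ku_ku_k^*$, and stop if $\|(\hat A_{k+1})_{\mathrm{st}}\|_F\le\gamma$. A run is a finite sequence of such rounds. **Theorem.** Let $n\ge1$, let $A$ be an $n\times n$ dual quaternion Hermitian matrix, and let $\gamma\ge0$ satisfy $\gamma<|\mu_{\mathrm{st}}|$ for every appreciable right eigenvalue $\mu$ of $A$. 1. Suppose a run stops with outputs $(\lambda_k,u_k)$, $1\le k\le K$. Each appreciable $\lambda_k$ is a dual number, $\|u_k\|_2=1$ and $Au_k=u_k\lambda_k$; the $u_k$ that belong to appreciable $\lambda_k$ are mutually orthogonal; and every appreciable right eigenvalue of $A$ is one of the $\lambda_k$. Moreover, there are $U$ with $U^*U=I$ and dual numbers $\sigma_1,\dots,\sigma_n$ with $U^*AU=\operatorname{diag}(\sigma_1,\dots,\sigma_n)$ such that the returned pairs with $\lambda_k$ appreciable are, each exactly once, the pairs ($\sigma_i$, $i$-th column of $U$) with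 $\sigma_i$ appreciable. So all appreciable eigenvalues are returned, with their multiplicities. 2. Suppose a run has reached $B=\hat A_{k}$ ($k\ge1$) with $\|B_{\mathrm{st}}\|_F>\gamma$. Then $B$ has a dominant unit eigenpair, that is, an eigenpair $(\mu,x)$ with $\|x\|_2=1$ and $|\mu_{\mathrm{st}}|$ maximal among the right eigenvalues of $B$. For every such pair, $\mu$ is appreciable and there is $\delta>0$ such that RQI for $B$ returns $(\mu,x')$ for some $x'$, from every unit $u_0$ such that all entries of $(u_0)_{\mathrm{st}}-x_{\mathrm{st}}$ have modulus less than $\delta$ and $(y^*u_0)_{\mathrm{st}}=0$ for every eigenvector $y$ of $B$ with an eigenvalue $\nu\neq\mu$, $\nu_{\mathrm{st}}=\mu_{\mathrm{st}}$. 3. In every run, at most $n$ rounds return an appreciable eigenvalue. 4. Some run stops after at most $n$ rounds, and if $A$ has an appreciable right eigenvalue, it can be chosen so that all returned eigenvalues are appreciable. -/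

import Mathlib

open Filter Topology Quaternion Matrix

noncomputable section

namespace DualQuat

/-- Dual quaternions `q = q_st + q_I ε`, `ε ^ 2 = 0`, with `q.fst = q_st` the standard part and
`q.snd = q_I` the dual part; addition and multiplication are Mathlib's for dual numbers over `ℍ[ℝ]`.
The (real) dual numbers are `DualNumber ℝ`. -/
abbrev DQ : Type := DualNumber ℍ[ℝ]

/-- The conjugate `q* = q_st* + q_I* ε`. -/
instance : StarRing DQ where
  star q := TrivSqZeroExt.inl (star q.fst) + TrivSqZeroExt.inr (star q.snd)
  star_involutive q := by
    apply TrivSqZeroExt.ext <;> simp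
  star_mul p q := by
    apply TrivSqZeroExt.ext <;> simp [add_comm]
  star_add p q := by
    apply TrivSqZeroExt.ext <;> simp

@[simp] theorem fst_star (q : DQ) : (star q).fst = star q.fst := by
  simp [star]

@[simp] theorem snd_star (q : DQ) : (star q).snd = star q.snd := by
  simp [star]

/-- A dual quaternion is appreciable if its standard part is nonzero. -/
def IsAppreciable (q : DQ) : Prop := q.fst ≠ 0

/-- The inclusion of the dual numbers in the dual quaternions. -/
def ofDual (a : DualNumber ℝ) : DQ :=
  TrivSqZeroExt.inl (a.fst : ℍ[ℝ]) + TrivSqZeroExt.inr (a.snd : ℍ[ℝ])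

/-- The magnitude of a dual quaternion, a dual number. (The quaternion
`q_st q_I* + q_I q_st*` is real; `.re` reads it as a real number.) -/
def magnitude (q : DQ) : DualNumber ℝ :=
  open Classical in
  if q.fst ≠ 0 then
    TrivSqZeroExt.inl ‖q.fst‖ +
      TrivSqZeroExt.inr ((q.fst * star q.snd + q.snd * star q.fst).re / (2 * ‖q.fst‖))
  else TrivSqZeroExt.inr ‖q.snd‖

/-- The square root of a positive appreciable dual number. -/
def dualSqrt (a : DualNumber ℝ) : DualNumber ℝ :=
  TrivSqZeroExt.inl (Real.sqrt a.fst) + TrivSqZeroExt.inr (a.snd / (2 * Real.sqrt a.fst))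

/-- Dual quaternion column vectors. -/
abbrev Vec (n : ℕ) : Type := Fin n → DQ

/-- Square dual quaternion matrices. -/
abbrev Mat (n : ℕ) : Type := Matrix (Fin n) (Fin n) DQ

variable {n : ℕ}

/-- A vector is appreciable if its standard part is nonzero. -/
def IsAppreciableVec (x : Vec n) : Prop := ∃ i, (x i).fst ≠ 0

/-- The 2-norm of a dual quaternion vector, a dual number. -/
def norm₂ (x : Vec n) : DualNumber ℝ :=
  open Classical in
  if IsAppreciableVec x then dualSqrt (∑ i, magnitude (x i) ^ 2)
  else TrivSqZeroExt.inr (Real.sqrt (∑ i, ‖(x i).snd‖ ^ 2))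

/-- The inner product `⟨x, y⟩ = y* x`. -/
def innerDQ (x y : Vec n) : DQ := star y ⬝ᵥ x

/-- `(μ, x)` is a right eigenpair of `A`: `x` is appreciable and `A x = x μ`. -/
def IsEigenpair (A : Mat n) (μ : DQ) (x : Vec n) : Prop :=
  IsAppreciableVec x ∧ A *ᵥ x = fun i => x i * μ

/-- `μ` is a right eigenvalue of `A`. -/
def IsEigenvalue (A : Mat n) (μ : DQ) : Prop := ∃ x, IsEigenpair A μ x

/-- The Frobenius norm of the standard part of a matrix. -/
def frobSt (A : Mat n) : ℝ := Real.sqrt (∑ i, ∑ j, ‖(A i j).fst‖ ^ 2)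

/-- The Rayleigh quotient `u* A u` of a unit vector. -/
def rayleigh (A : Mat n) (u : Vec n) : DQ := star u ⬝ᵥ (A *ᵥ u)

/-- The shifted matrix `A - θ I`, where `θ = u* A u`. -/
def shifted (A : Mat n) (u : Vec n) : Mat n := A - rayleigh A u • (1 : Mat n)

/-- One step `u ↦ u'` of the Rayleigh quotient iteration with a nonsingular shift:
`(A - θ I) w = u` with `θ = u* A u`, and `u' = w / ‖w‖₂`. -/
def IsRQIStep (A : Mat n) (u u' : Vec n) : Prop :=
  IsUnit (shifted A u) ∧
    ∃ w : Vec n, shifted A u *ᵥ w = u ∧ u' = fun i => w i * ofDual (norm₂ w)⁻¹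

/-- The Rayleigh quotient iteration for `A`, started from the unit vector `u₀` and carried out in
exact arithmetic with tolerance zero and no bound on the number of steps, returns `(μ, x)`:
* either, after finitely many steps, the shift `θ_N` makes `A - θ_N I` singular, `x` is a
  unit solution of `(A - θ_N I) x = 0`, and `μ = θ_N`;
* or all shifts are nonsingular, `θ_k → μ`, and `u_k → x` up to sign. -/
def RQIReturns (A : Mat n) (u₀ : Vec n) (μ : DQ) (x : Vec n) : Prop :=
  norm₂ u₀ = 1 ∧
  ∃ u : ℕ → Vec n, u 0 = u₀ ∧
    ((∃ N : ℕ, (∀ k < N, IsRQIStep A (u k) (u (k + 1))) ∧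
        ¬ IsUnit (shifted A (u N)) ∧
        norm₂ x = 1 ∧ shifted A (u N) *ᵥ x = 0 ∧ μ = rayleigh A (u N)) ∨
      ((∀ k, IsRQIStep A (u k) (u (k + 1))) ∧
        Tendsto (fun k => rayleigh A (u k)) atTop (𝓝 μ) ∧
        ∃ s : ℕ → ℝ, (∀ k, s k = 1 ∨ s k = -1) ∧
          Tendsto (fun k => s k • u k) atTop (𝓝 x)))

/-- The deflated matrices: `A` after subtracting `λ_i u_i u_i*` for `i < k`. -/
def deflate (A : Mat n) (lam : ℕ → DQ) (u : ℕ → Vec n) : ℕ → Mat n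
  | 0 => A
  | k + 1 => deflate A lam u k - lam k • vecMulVec (u k) (star (u k))

/-- `(λ_k, u_k)`, `k < K`, are the outputs of the first `K` rounds of the deflation procedure for
`A` with tolerance `γ`: each is returned by the Rayleigh quotient iteration, from some unit
starting vector, for the current deflated matrix, and the stopping test
`‖(A_k)_st‖_F ≤ γ` failed after every earlier round. -/
def IsRun (A : Mat n) (γ : ℝ) (K : ℕ) (lam : ℕ → DQ) (u : ℕ → Vec n) : Prop :=
  (∀ k < K, ∃ u₀, RQIReturns (deflate A lam u k) u₀ (lam k) (u k)) ∧
    ∀ k < K, 0 < k → γ < frobSt (deflate A lam u k)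

/-- The procedure stops after exactly `K` rounds with outputs `(λ_k, u_k)`, `k < K`. -/
def StopsWith (A : Mat n) (γ : ℝ) (K : ℕ) (lam : ℕ → DQ) (u : ℕ → Vec n) : Prop :=
  IsRun A γ K lam u ∧ 0 < K ∧ frobSt (deflate A lam u K) ≤ γ

/-- `(μ, x)` is a unit eigenpair of `A` with `|μ_st|` largest among all eigenvalues of `A`. -/
def IsDominantPair (A : Mat n) (μ : DQ) (x : Vec n) : Prop :=
  norm₂ x = 1 ∧ IsEigenpair A μ x ∧ ∀ ν, IsEigenvalue A ν → ‖ν.fst‖ ≤ ‖μ.fst‖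

end DualQuat

end

/-! Appreciable dual quaternions are invertible, so the usual Hermitian arguments survive as long as
only appreciable quantities are cancelled. In particular, eigenvectors whose eigenvalues have
different standard parts are orthogonal (`dotProduct_eq_zero_of_fst_ne`). The spectral theorem rests
on first-order perturbation theory: `exists_dual_eigenvector` produces one eigenvector from the real
spectral theorem on `ℍⁿ`, and `Orthonormal.exists_eigenvector` extends any incomplete orthonormal
family of eigenvectors.

Whatever the iteration returns is a unit eigenpair (`RQIReturns.eigen`): the residual is a multiple
of the previous iterate, and that multiple tends to zero. Splitting off a pair turns its vector into
an eigenvector for 0, so appreciable eigenvectors of a deflated matrix are orthogonal to it and are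
eigenvectors of the matrix before (`IsDeflation.eigen_of_deflate`). Hence the appreciable outputs
are orthonormal eigenvectors of `A`, and there are at most `n` of them. At the stop no appreciable
eigenvalue can be left, since it would exceed `γ` while being bounded by the Frobenius norm.
Completing the outputs to an eigenbasis then adds only infinitesimal eigenvalues
(`IsDeflation.exists_unitary`).

For local convergence the iteration is written in spectral coordinates. With `e` the error of the
Rayleigh quotient and `d i` the distance of the `i`-th eigenvalue from the target, one step
multiplies coordinate `i` by `-e / (d i - e)`, up to a common factor. This is at most 1/2 in
standard part outside the target eigenspace, once the start is close enough. Extremality of the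
target gives all `d i` one sign, so `e` has nonzero standard part and no shift is singular. Dual
parts are controlled by a bootstrap: they enter the error only multiplied by small standard parts
(`RQHyp.tendsto`). A stopping run is obtained by starting each round at an eigenvector. -/

noncomputable section

namespace DualQuat

section

/-! ### Dual numbers inside the dual quaternions -/

@[simp] theorem fst_ofDual (a : DualNumber ℝ) : (ofDual a).fst = (a.fst : ℍ[ℝ]) := by
  simp [ofDual]

@[simp] theorem snd_ofDual (a : DualNumber ℝ) : (ofDual a).snd = (a.snd : ℍ[ℝ]) := by
  simp [ofDual]

@[simp] theorem ofDual_zero : ofDual 0 = 0 := by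
  apply TrivSqZeroExt.ext <;> simp

@[simp] theorem ofDual_one : ofDual 1 = 1 := by
  apply TrivSqZeroExt.ext <;> simp

theorem ofDual_add (a b : DualNumber ℝ) : ofDual (a + b) = ofDual a + ofDual b := by
  apply TrivSqZeroExt.ext <;> simp

theorem ofDual_neg (a : DualNumber ℝ) : ofDual (-a) = -ofDual a := by
  apply TrivSqZeroExt.ext <;> simp

theorem ofDual_sub (a b : DualNumber ℝ) : ofDual (a - b) = ofDual a - ofDual b := by
  apply TrivSqZeroExt.ext <;> simp

theorem ofDual_mul (a b : DualNumber ℝ) : ofDual (a * b) = ofDual a * ofDual b := by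
  apply TrivSqZeroExt.ext <;> simp

theorem ofDual_injective : Function.Injective ofDual := by
  intro a b h
  apply TrivSqZeroExt.ext
  · have := congrArg (fun q : DQ => q.fst.re) h
    simpa using this
  · have := congrArg (fun q : DQ => q.snd.re) h
    simpa using this

theorem ofDual_sum {ι : Type*} (s : Finset ι) (f : ι → DualNumber ℝ) :
    ofDual (∑ i ∈ s, f i) = ∑ i ∈ s, ofDual (f i) := by
  classical
  induction s using Finset.induction_on with
  | empty => simp
  | insert a s ha ih => rw [Finset.sum_insert ha, Finset.sum_insert ha, ofDual_add, ih]

theorem ofDual_comm (a : DualNumber ℝ) (q : DQ) : ofDual a * q = q * ofDual a := by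
  apply TrivSqZeroExt.ext <;>
    simp [(Quaternion.coe_commutes _ _), add_comm]

@[simp] theorem star_ofDual (a : DualNumber ℝ) : star (ofDual a) = ofDual a := by
  apply TrivSqZeroExt.ext <;> simp

theorem exists_ofDual_of_star_eq {q : DQ} (h : star q = q) : ∃ a, q = ofDual a := by
  have h1 : star q.fst = q.fst := by rw [← fst_star, h]
  have h2 : star q.snd = q.snd := by rw [← snd_star, h]
  refine ⟨TrivSqZeroExt.inl q.fst.re + TrivSqZeroExt.inr q.snd.re, ?_⟩
  apply TrivSqZeroExt.ext
  · simpa using Quaternion.star_eq_self.1 h1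
  · simpa using Quaternion.star_eq_self.1 h2

theorem isAppreciable_ofDual {a : DualNumber ℝ} : IsAppreciable (ofDual a) ↔ a.fst ≠ 0 := by
  rw [IsAppreciable, fst_ofDual, ← norm_ne_zero_iff, Quaternion.norm_coe, norm_ne_zero_iff]

theorem norm_fst_ofDual (a : DualNumber ℝ) : ‖(ofDual a).fst‖ = |a.fst| := by
  simp

theorem ofDual_mul_inv {a : DualNumber ℝ} (h : a.fst ≠ 0) : ofDual a * ofDual a⁻¹ = 1 := by
  rw [← ofDual_mul, TrivSqZeroExt.mul_inv_cancel h, ofDual_one]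

theorem IsAppreciable.isUnit {q : DQ} (h : IsAppreciable q) : IsUnit q :=
  TrivSqZeroExt.isUnit_iff_isUnit_fst.2 (isUnit_iff_ne_zero.2 h)

theorem mul_eq_zero_of_fst_eq_zero {p q : DQ} (hp : p.fst = 0) (hq : q.fst = 0) : p * q = 0 := by
  apply TrivSqZeroExt.ext <;> simp [hp, hq]

/-- The dual number `q* q`. -/
def nsq (q : DQ) : DualNumber ℝ :=
  TrivSqZeroExt.inl (‖q.fst‖ ^ 2) + TrivSqZeroExt.inr (2 * (star q.fst * q.snd).re)

@[simp] theorem fst_nsq (q : DQ) : (nsq q).fst = ‖q.fst‖ ^ 2 := by simp [nsq]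

@[simp] theorem snd_nsq (q : DQ) : (nsq q).snd = 2 * (star q.fst * q.snd).re := by simp [nsq]

theorem ofDual_nsq (q : DQ) : ofDual (nsq q) = star q * q := by
  apply TrivSqZeroExt.ext
  · simp [Quaternion.star_mul_self, Quaternion.normSq_eq_norm_mul_self, sq]
  · simp only [snd_ofDual, snd_nsq, TrivSqZeroExt.snd_mul, fst_star, snd_star, smul_eq_mul,
      MulOpposite.smul_eq_mul_unop, MulOpposite.unop_op]
    have := Quaternion.self_add_star (star q.fst * q.snd)
    rw [star_mul, star_star] at this
    rw [this]
    push_cast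
    rfl

theorem nsq_mul_ofDual (q : DQ) (a : DualNumber ℝ) : nsq (q * ofDual a) = nsq q * a ^ 2 := by
  apply ofDual_injective
  rw [ofDual_nsq, star_mul, star_ofDual, sq, ofDual_mul, ofDual_mul, ofDual_nsq, ofDual_comm a,
    mul_assoc (star q), ofDual_comm a, mul_assoc (star q), mul_assoc q]

theorem nsq_eq_zero {q : DQ} (h : q.fst = 0) : nsq q = 0 := by
  apply TrivSqZeroExt.ext <;> simp [h]

/-- The dual number `x* x`. -/
def vnsq {n : ℕ} (x : Vec n) : DualNumber ℝ := ∑ i, nsq (x i)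

variable {n : ℕ}

theorem ofDual_vnsq (x : Vec n) : ofDual (vnsq x) = star x ⬝ᵥ x := by
  simp [vnsq, ofDual_sum, ofDual_nsq, dotProduct]

theorem fst_vnsq (x : Vec n) : (vnsq x).fst = ∑ i, ‖(x i).fst‖ ^ 2 := by
  simp [vnsq, TrivSqZeroExt.fst_sum]

theorem snd_vnsq (x : Vec n) : (vnsq x).snd = ∑ i, 2 * (star (x i).fst * (x i).snd).re := by
  simp [vnsq, TrivSqZeroExt.snd_sum]

theorem vnsq_mul_ofDual (x : Vec n) (a : DualNumber ℝ) :
    vnsq (fun i => x i * ofDual a) = vnsq x * a ^ 2 := by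
  simp [vnsq, nsq_mul_ofDual, Finset.sum_mul]

theorem fst_vnsq_pos_iff {x : Vec n} : 0 < (vnsq x).fst ↔ IsAppreciableVec x := by
  rw [fst_vnsq]
  constructor
  · intro h
    by_contra hx
    simp only [IsAppreciableVec, not_exists, not_not] at hx
    simp [hx] at h
  · rintro ⟨i, hi⟩
    exact Finset.sum_pos' (fun _ _ => by positivity) ⟨i, Finset.mem_univ _, by positivity⟩

theorem magnitude_sq (q : DQ) : magnitude q ^ 2 = nsq q := by
  unfold magnitude
  split_ifs with h
  · have hn : ‖q.fst‖ ≠ 0 := norm_ne_zero_iff.2 h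
    apply TrivSqZeroExt.ext
    · simp [sq]
    · have e1 : (q.fst * star q.snd).re = (star q.fst * q.snd).re := by
        rw [← Quaternion.re_star, star_mul, star_star, Quaternion.re_mul, Quaternion.re_mul]
        simp only [Quaternion.re_star, Quaternion.imI_star, Quaternion.imJ_star,
          Quaternion.imK_star]
        ring
      have e2 : (q.snd * star q.fst).re = (star q.fst * q.snd).re := by
        rw [Quaternion.re_mul, Quaternion.re_mul]
        simp only [Quaternion.re_star, Quaternion.imI_star, Quaternion.imJ_star,
          Quaternion.imK_star]
        ring
      simp only [sq, TrivSqZeroExt.snd_mul, TrivSqZeroExt.fst_add, TrivSqZeroExt.snd_add,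
        TrivSqZeroExt.fst_inl, TrivSqZeroExt.fst_inr, TrivSqZeroExt.snd_inl,
        TrivSqZeroExt.snd_inr, Quaternion.re_add, e1, e2, snd_nsq, smul_eq_mul,
        MulOpposite.smul_eq_mul_unop, MulOpposite.unop_op, add_zero, zero_add]
      field_simp
      ring
  · rw [nsq_eq_zero (not_not.1 h), sq]
    apply TrivSqZeroExt.ext <;> simp

theorem norm₂_eq {x : Vec n} (h : IsAppreciableVec x) : norm₂ x = dualSqrt (vnsq x) := by
  rw [norm₂, if_pos h, vnsq]
  simp only [magnitude_sq]

theorem dualSqrt_sq {a : DualNumber ℝ} (h : 0 < a.fst) : dualSqrt a ^ 2 = a := by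
  have h1 := Real.sqrt_pos.2 h
  apply TrivSqZeroExt.ext
  · simp [dualSqrt, sq, Real.mul_self_sqrt h.le]
  · simp [dualSqrt, sq]
    field_simp
    ring

theorem fst_dualSqrt_pos {a : DualNumber ℝ} (h : 0 < a.fst) : 0 < (dualSqrt a).fst := by
  simpa [dualSqrt] using h

/-- Dual numbers have zero divisors, but `a + b` has positive standard part, hence cancels from `(a
- b) * (a + b) = 0`. -/
theorem dual_eq_of_sq_eq {a b : DualNumber ℝ} (ha : 0 < a.fst) (hb : 0 < b.fst)
    (h : a ^ 2 = b ^ 2) : a = b := by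
  have h1 : (a - b) * (a + b) = 0 := by linear_combination h
  have h2 : (a + b).fst ≠ 0 := by simp; positivity
  have h3 : (a - b) * ((a + b) * (a + b)⁻¹) = 0 := by rw [← mul_assoc, h1, zero_mul]
  rw [TrivSqZeroExt.mul_inv_cancel h2, mul_one] at h3
  exact sub_eq_zero.1 h3

theorem norm₂_eq_of_sq {x : Vec n} {b : DualNumber ℝ} (hb : 0 < b.fst) (h : b ^ 2 = vnsq x) :
    norm₂ x = b := by
  have hx : 0 < (vnsq x).fst := by rw [← h, TrivSqZeroExt.fst_pow]; positivity
  rw [norm₂_eq (fst_vnsq_pos_iff.1 hx)]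
  exact dual_eq_of_sq_eq (fst_dualSqrt_pos hx) hb (by rw [dualSqrt_sq hx, h])

theorem norm₂_eq_one_iff {x : Vec n} : norm₂ x = 1 ↔ star x ⬝ᵥ x = 1 := by
  rw [← ofDual_vnsq, ← ofDual_one, ofDual_injective.eq_iff]
  constructor
  · intro h
    by_cases hx : IsAppreciableVec x
    · rw [norm₂_eq hx] at h
      rw [← dualSqrt_sq (fst_vnsq_pos_iff.2 hx), h, one_pow]
    · rw [norm₂, if_neg hx] at h
      have := congrArg TrivSqZeroExt.fst h
      simp at this
  · intro h
    exact norm₂_eq_of_sq (by simp) (by rw [h, one_pow])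

theorem isAppreciableVec_of_unit {x : Vec n} (h : star x ⬝ᵥ x = 1) : IsAppreciableVec x := by
  rw [← ofDual_vnsq, ← ofDual_one, ofDual_injective.eq_iff] at h
  exact fst_vnsq_pos_iff.1 (by rw [h]; simp)

/-! ### Hermitian matrices -/

theorem mulVec_mul_right {m n : ℕ} (A : Matrix (Fin m) (Fin n) DQ) (x : Vec n) (c : DQ) :
    (A *ᵥ fun i => x i * c) = fun i => (A *ᵥ x) i * c := by
  ext1 i
  simp [mulVec, dotProduct, Finset.sum_mul, mul_assoc]

theorem dotProduct_mul_right (x y : Vec n) (c : DQ) :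
    (x ⬝ᵥ fun i => y i * c) = x ⬝ᵥ y * c := by
  simp [dotProduct, Finset.sum_mul, mul_assoc]

theorem ofDual_smul_vec (a : DualNumber ℝ) (x : Vec n) :
    ofDual a • x = fun i => x i * ofDual a := by
  ext1 i
  simp [ofDual_comm]

theorem star_mulVec_dotProduct {m n : ℕ} (A : Matrix (Fin m) (Fin n) DQ) (x : Vec n) (y : Vec m) :
    star (A *ᵥ x) ⬝ᵥ y = star x ⬝ᵥ (Aᴴ *ᵥ y) := by
  rw [star_mulVec, dotProduct_mulVec]

theorem rayleigh_real {A : Mat n} (hA : A.IsHermitian) (u : Vec n) :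
    ∃ a, rayleigh A u = ofDual a := by
  apply exists_ofDual_of_star_eq
  rw [rayleigh, ← star_dotProduct, star_mulVec_dotProduct, hA.eq]

theorem shifted_mulVec {A : Mat n} {u : Vec n} {a : DualNumber ℝ} (h : rayleigh A u = ofDual a)
    (x : Vec n) : shifted A u *ᵥ x = fun i => (A *ᵥ x) i - x i * ofDual a := by
  rw [shifted, h, sub_mulVec, smul_mulVec, one_mulVec, ofDual_smul_vec]
  rfl

/-- In `x* A x = (x* x) μ` both `x* A x` and `x* x` are dual numbers, and `x* x` is invertible
because `x` is appreciable. -/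
theorem IsEigenpair.exists_ofDual {A : Mat n} (hA : A.IsHermitian) {μ : DQ} {x : Vec n}
    (h : IsEigenpair A μ x) : ∃ a, μ = ofDual a := by
  obtain ⟨a, ha⟩ := rayleigh_real hA x
  have h1 : ofDual (vnsq x) * μ = ofDual a := by
    rw [← ha, rayleigh, h.2, dotProduct_mul_right, ofDual_vnsq]
  refine ⟨(vnsq x)⁻¹ * a, ?_⟩
  have hx : (vnsq x).fst ≠ 0 := (fst_vnsq_pos_iff.2 h.1).ne'
  rw [ofDual_mul, ← h1, ← mul_assoc, ← ofDual_mul, TrivSqZeroExt.inv_mul_cancel hx, ofDual_one,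
    one_mul]

/-- Eigenvectors of a Hermitian matrix for eigenvalues with distinct standard parts are
orthogonal. -/
theorem dotProduct_eq_zero_of_fst_ne {A : Mat n} (hA : A.IsHermitian) {a b : DualNumber ℝ}
    {x y : Vec n} (hx : A *ᵥ x = fun i => x i * ofDual a) (hy : A *ᵥ y = fun i => y i * ofDual b)
    (hab : a.fst ≠ b.fst) : star y ⬝ᵥ x = 0 := by
  have h1 : star y ⬝ᵥ (A *ᵥ x) = star y ⬝ᵥ x * ofDual a := by rw [hx, dotProduct_mul_right]
  have h2 : star y ⬝ᵥ (A *ᵥ x) = star y ⬝ᵥ x * ofDual b := by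
    have h3 : star (A *ᵥ y) ⬝ᵥ x = star y ⬝ᵥ (A *ᵥ x) := by
      rw [star_mulVec_dotProduct, hA.eq]
    rw [← h3, star_dotProduct, hy, dotProduct_mul_right, star_mul, star_ofDual, ← star_dotProduct,
      ofDual_comm]
  -- Distinct standard parts make `a - b` invertible. A nonzero infinitesimal difference would only
  -- give `(y* x)_st = 0`.
  have h4 : star y ⬝ᵥ x * ofDual (a - b) = 0 := by
    rw [ofDual_sub, mul_sub, ← h1, ← h2, sub_self]
  have h5 : (a - b).fst ≠ 0 := by simpa [sub_eq_zero] using hab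
  have h6 := congrArg (fun t => t * ofDual (a - b)⁻¹) h4
  simpa [mul_assoc, ofDual_mul_inv h5] using h6

end

section

/-! ### Eigenpairs of a dual symmetric operator -/

section Real

variable {V : Type*} [NormedAddCommGroup V] [InnerProductSpace ℝ V] [FiniteDimensional ℝ V]

theorem exists_eigenvector_of_ne_smul {T : V →ₗ[ℝ] V} (hT : T.IsSymmetric) {τ : ℝ}
    (h : T ≠ τ • LinearMap.id) : ∃ l : ℝ, l ≠ τ ∧ ∃ x : V, x ≠ 0 ∧ T x = l • x := by
  by_contra! hc
  apply h
  refine (hT.eigenvectorBasis rfl).toBasis.ext fun i => ?_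
  have h1 := hT.apply_eigenvectorBasis rfl i
  have h2 : hT.eigenvalues rfl i = τ := by
    by_contra hne
    exact hc _ hne _ ((hT.eigenvectorBasis rfl).orthonormal.ne_zero i) h1
  simp only [OrthonormalBasis.coe_toBasis, LinearMap.smul_apply, LinearMap.id_apply]
  rw [h1, h2]
  rfl

/-- The operator `T + S ε` has a unit eigenvector `x₀ + x₁ ε` with an eigenvalue `l + m ε`,
`l ≠ τ`, unless `T = τ`. -/
theorem exists_dual_eigenvector {T S : V →ₗ[ℝ] V} (hT : T.IsSymmetric) (hS : S.IsSymmetric) {τ : ℝ}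
    (h : T ≠ τ • LinearMap.id) :
    ∃ (l m : ℝ) (x₀ x₁ : V), l ≠ τ ∧ ‖x₀‖ = 1 ∧ inner ℝ x₀ x₁ = 0 ∧ T x₀ = l • x₀ ∧
      T x₁ + S x₀ = l • x₁ + m • x₀ := by
  obtain ⟨l, hl, z, hz, hTz⟩ := exists_eigenvector_of_ne_smul hT h
  set T' : V →ₗ[ℝ] V := T - l • LinearMap.id with hT'
  have hT's : T'.IsSymmetric := by
    intro x y
    simp only [hT', LinearMap.sub_apply, LinearMap.smul_apply, LinearMap.id_apply,
      inner_sub_left, inner_sub_right, hT x y, inner_smul_left, inner_smul_right]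
    simp
  set E : Submodule ℝ V := LinearMap.ker T' with hE
  have hzE : z ∈ E := by simp [hE, hT', hTz]
  have : Nontrivial E := ⟨⟨⟨z, hzE⟩, 0, fun hc => hz (congrArg Subtype.val hc)⟩⟩
  -- The dual part of the eigenvalue equation is `(T - l) x₁ = m x₀ - S x₀`. It is solvable iff the
  -- right side is orthogonal to `E = ker (T - l)`, that is, iff `x₀` is an eigenvector of the
  -- compression of `S` to `E` with eigenvalue `m`.
  set S' : E →ₗ[ℝ] E := E.orthogonalProjectionOnto.toLinearMap ∘ₗ S ∘ₗ E.subtype with hS'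
  have hS's : S'.IsSymmetric := by
    intro x y
    simp only [hS', LinearMap.comp_apply, Submodule.subtype_apply, ContinuousLinearMap.coe_coe]
    rw [Submodule.inner_orthogonalProjectionOnto_eq_of_mem_right, hS,
      Submodule.inner_orthogonalProjectionOnto_eq_of_mem_left]
  obtain ⟨v, hv⟩ := hS's.hasEigenvalue_iSup_of_finiteDimensional.exists_hasEigenvector
  set m := _
  have hv : Module.End.HasEigenvector S' m v := hv
  have hv0 : (v : V) ≠ 0 := fun hc => hv.2 (Subtype.ext hc)
  set x₀ : V := ‖(v : V)‖⁻¹ • (v : V) with hx₀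
  have hx₀E : x₀ ∈ E := E.smul_mem _ v.2
  have hSx : S x₀ - m • x₀ ∈ Eᗮ := by
    rw [hx₀, map_smul, smul_comm m, ← smul_sub]
    refine Submodule.smul_mem _ _ ?_
    have h1 : S' v = m • v := hv.apply_eq_smul
    have h2 : ((S' v : E) : V) = m • (v : V) := by rw [h1]; rfl
    rw [← h2]
    exact E.sub_starProjection_mem_orthogonal (S (v : V))
  have hER : Eᗮ = LinearMap.range T' := by
    rw [hE, ← hT's.orthogonal_range, Submodule.orthogonal_orthogonal]
  rw [hER] at hSx
  obtain ⟨y, hy⟩ := hSx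
  have hTx : T x₀ = l • x₀ := by
    have : T' x₀ = 0 := hx₀E
    simpa [hT', sub_eq_zero] using this
  have hn : ‖x₀‖ = 1 := by
    rw [hx₀, norm_smul, norm_inv, norm_norm, inv_mul_cancel₀ (norm_ne_zero_iff.2 hv0)]
  -- The vector `-y` solves the equation. Adding a multiple of `x₀ ∈ E` keeps it a solution and
  -- makes it orthogonal to `x₀`, which kills the dual part of the squared norm.
  refine ⟨l, m, x₀, -y + (inner ℝ x₀ y) • x₀, hl, hn, ?_, hTx, ?_⟩
  · rw [inner_add_right, inner_neg_right, inner_smul_right, real_inner_self_eq_norm_sq, hn]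
    simp
  · have h3 : T y - l • y = S x₀ - m • x₀ := by simpa [hT'] using hy
    rw [map_add, map_neg, map_smul, hTx]
    rw [sub_eq_iff_eq_add.1 h3]
    module

end Real

variable {n : ℕ}

/-- The real operator of a quaternion matrix on `ℍⁿ`. -/
def realOp (M : Matrix (Fin n) (Fin n) ℍ[ℝ]) :
    PiLp 2 (fun _ : Fin n => ℍ[ℝ]) →ₗ[ℝ] PiLp 2 (fun _ : Fin n => ℍ[ℝ]) where
  toFun x := WithLp.toLp 2 (M *ᵥ WithLp.ofLp x)
  map_add' x y := by simp [mulVec_add]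
  map_smul' r x := by
    simp only [WithLp.ofLp_smul, RingHom.id_apply]
    rw [mulVec_smul]
    rfl

theorem realOp_apply (M : Matrix (Fin n) (Fin n) ℍ[ℝ]) (x : PiLp 2 (fun _ : Fin n => ℍ[ℝ]))
    (i : Fin n) : realOp M x i = ∑ j, M i j * x j := rfl

theorem re_mul_comm (p q : ℍ[ℝ]) : (p * q).re = (q * p).re := by
  simp only [Quaternion.re_mul]
  ring

theorem re_sum {ι : Type*} (s : Finset ι) (f : ι → ℍ[ℝ]) :
    (∑ i ∈ s, f i).re = ∑ i ∈ s, (f i).re := by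
  classical
  induction s using Finset.induction_on with
  | empty => simp
  | insert a s ha ih => rw [Finset.sum_insert ha, Finset.sum_insert ha, Quaternion.re_add, ih]

/-- The real inner product is the real part of the quaternionic one, and `re (p q) = re (q p)`.
Passing to `ℝ` loses nothing: a real eigenvalue acts alike from the left and from the right. -/
theorem realOp_isSymmetric {M : Matrix (Fin n) (Fin n) ℍ[ℝ]} (hM : ∀ i j, star (M i j) = M j i) :
    (realOp M).IsSymmetric := by
  intro x y
  simp only [PiLp.inner_apply, realOp_apply, Quaternion.inner_def, Finset.sum_mul, star_sum,
    Finset.mul_sum, re_sum]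
  rw [Finset.sum_comm]
  refine Finset.sum_congr rfl fun i _ => Finset.sum_congr rfl fun j _ => ?_
  rw [star_mul, hM, mul_assoc, re_mul_comm, mul_assoc]

/-- A dual quaternion Hermitian matrix whose standard part is not `τ I` has a unit eigenvector with
an eigenvalue whose standard part is not `τ`. -/
theorem exists_eigenpair_fst_ne {A : Mat n} (hA : A.IsHermitian) (τ : ℝ)
    (h : ∃ i j, (A i j).fst ≠ if i = j then (τ : ℍ[ℝ]) else 0) :
    ∃ (a : DualNumber ℝ) (x : Vec n), a.fst ≠ τ ∧ star x ⬝ᵥ x = 1 ∧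
      A *ᵥ x = fun i => x i * ofDual a := by
  have hA' : ∀ i j, star (A i j) = A j i := fun i j => hA.apply j i
  have hT : (realOp (A.map TrivSqZeroExt.fst)).IsSymmetric :=
    realOp_isSymmetric fun i j => by rw [map_apply, ← fst_star, hA', map_apply]
  have hS : (realOp (A.map TrivSqZeroExt.snd)).IsSymmetric :=
    realOp_isSymmetric fun i j => by rw [map_apply, ← snd_star, hA', map_apply]
  have hne : realOp (A.map TrivSqZeroExt.fst) ≠ τ • LinearMap.id := by
    obtain ⟨i, j, hij⟩ := h
    intro hc
    apply hij
    have h1 : ∑ k, (A i k).fst * (Pi.single j 1 : Fin n → ℍ[ℝ]) k =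
        τ • (Pi.single j 1 : Fin n → ℍ[ℝ]) i := by
      have h2 := congrArg (fun f => f (WithLp.toLp 2 (Pi.single j 1))) hc
      exact congrArg (fun f : PiLp 2 (fun _ : Fin n => ℍ[ℝ]) => f i) h2
    rw [Finset.sum_eq_single j (fun b _ hb => by simp [hb]) (by simp)] at h1
    by_cases hji : i = j
    · subst hji
      simpa [← Quaternion.coe_mul_eq_smul] using h1
    · simpa [hji] using h1
  obtain ⟨l, m, x₀, x₁, hl, hn, ho, h0, h1⟩ := exists_dual_eigenvector hT hS hne
  refine ⟨TrivSqZeroExt.inl l + TrivSqZeroExt.inr m,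
    fun i => TrivSqZeroExt.inl (x₀ i) + TrivSqZeroExt.inr (x₁ i), by simpa using hl, ?_, ?_⟩
  · rw [← ofDual_vnsq, ← ofDual_one, ofDual_injective.eq_iff]
    apply TrivSqZeroExt.ext
    · rw [fst_vnsq]
      have h2 := PiLp.norm_sq_eq_of_L2 _ x₀
      rw [hn] at h2
      simpa using h2.symm
    · rw [snd_vnsq, ← Finset.mul_sum]
      rw [PiLp.inner_apply] at ho
      simp only [Quaternion.inner_def] at ho
      simp only [TrivSqZeroExt.fst_add, TrivSqZeroExt.snd_add, TrivSqZeroExt.fst_inl,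
        TrivSqZeroExt.fst_inr, TrivSqZeroExt.snd_inl, TrivSqZeroExt.snd_inr, add_zero, zero_add,
        TrivSqZeroExt.snd_one]
      refine mul_eq_zero_of_right _ (Eq.trans ?_ ho)
      refine Finset.sum_congr rfl fun i _ => ?_
      rw [re_mul_comm, ← Quaternion.re_star, star_mul, star_star, re_mul_comm, re_mul_comm]
  · ext1 i
    have e0 : ∑ j, (A i j).fst * x₀ j = l • x₀ i :=
      congrArg (fun f : PiLp 2 (fun _ : Fin n => ℍ[ℝ]) => f i) h0
    have e1 : ∑ j, (A i j).fst * x₁ j + ∑ j, (A i j).snd * x₀ j = l • x₁ i + m • x₀ i :=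
      congrArg (fun f : PiLp 2 (fun _ : Fin n => ℍ[ℝ]) => f i) h1
    apply TrivSqZeroExt.ext
    · simp [mulVec, dotProduct, TrivSqZeroExt.fst_sum, e0, Quaternion.mul_coe_eq_smul]
    · simp only [mulVec, dotProduct, TrivSqZeroExt.snd_sum]
      simpa [Quaternion.mul_coe_eq_smul, Finset.sum_add_distrib, add_comm] using e1

end

section

/-! ### Orthonormal families of eigenvectors -/

variable {n : ℕ} {ι : Type*}

theorem card_le_of_mul_eq_one [Fintype ι] [DecidableEq ι] {κ : Type*} [Fintype κ] {N : Matrix ι κ DQ}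
    {W : Matrix κ ι DQ} (h : N * W = 1) : Fintype.card ι ≤ Fintype.card κ := by
  refine card_le_of_injective DQ (Matrix.vecMulLinear N) fun v w hvw => ?_
  have h1 : v ᵥ* N = w ᵥ* N := hvw
  rw [← vecMul_one v, ← vecMul_one w, ← h, ← vecMul_vecMul, ← vecMul_vecMul, h1]

/-- The matrix whose columns are the vectors `u k`. -/
def colMat (u : ι → Vec n) : Matrix (Fin n) ι DQ := Matrix.of fun i k => u k i

@[simp] theorem colMat_apply (u : ι → Vec n) (i : Fin n) (k : ι) : colMat u i k = u k i := rfl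

theorem conjTranspose_colMat_mul (u : ι → Vec n) (x : Vec n) (k : ι) :
    ((colMat u)ᴴ *ᵥ x) k = star (u k) ⬝ᵥ x := rfl

/-- The vectors `u k` are orthonormal. -/
def Orthonormal [DecidableEq ι] (u : ι → Vec n) : Prop := ∀ i j, star (u i) ⬝ᵥ u j = if i = j then 1 else 0

theorem orthonormal_iff [DecidableEq ι] {u : ι → Vec n} : Orthonormal u ↔ (colMat u)ᴴ * colMat u = 1 := by
  rw [← Matrix.ext_iff]
  simp only [Orthonormal, one_apply]
  rfl

theorem Orthonormal.card_le [Fintype ι] [DecidableEq ι] {u : ι → Vec n} (h : Orthonormal u) : Fintype.card ι ≤ n := by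
  simpa using card_le_of_mul_eq_one (orthonormal_iff.1 h)

/-- If the projection `P = U U*` had standard part `I`, then `1 - P` would be infinitesimal, so of
square zero, but also idempotent. Thus `P = 1`, which needs at least `n` columns. -/
theorem Orthonormal.exists_fst_ne [Fintype ι] [DecidableEq ι] {u : ι → Vec n} (h : Orthonormal u) (hc : Fintype.card ι < n) :
    ∃ i j, ((colMat u * (colMat u)ᴴ) i j).fst ≠ if i = j then 1 else 0 := by
  by_contra! hst
  set P := colMat u * (colMat u)ᴴ with hP
  have hPP : P * P = P := by
    rw [hP, Matrix.mul_assoc, ← Matrix.mul_assoc _ (colMat u) _, orthonormal_iff.1 h,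
      Matrix.one_mul]
  have h0 : (1 - P) * (1 - P) = 0 := by
    have h1 : ∀ i j, ((1 - P) i j).fst = 0 := by
      intro i j
      rw [Matrix.sub_apply, TrivSqZeroExt.fst_sub, hst, one_apply]
      split_ifs <;> simp
    ext1 i j
    rw [mul_apply]
    exact Finset.sum_eq_zero fun k _ => mul_eq_zero_of_fst_eq_zero (h1 _ _) (h1 _ _)
  have h2 : P = 1 := by
    have : (1 - P) * (1 - P) = 1 - P := by
      rw [sub_mul, mul_sub, mul_sub, hPP]
      simp
    rw [h0] at this
    exact (sub_eq_zero.1 this.symm).symm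
  have := card_le_of_mul_eq_one h2
  simp at this
  omega

/-- An orthonormal family of fewer than `n` eigenvectors can be extended. -/
theorem Orthonormal.exists_eigenvector [Fintype ι] [DecidableEq ι] {A : Mat n} (hA : A.IsHermitian) {u : ι → Vec n}
    (h : Orthonormal u) {σ : ι → DualNumber ℝ} (hσ : ∀ k, A *ᵥ u k = fun i => u k i * ofDual (σ k))
    (hc : Fintype.card ι < n) :
    ∃ (a : DualNumber ℝ) (x : Vec n), star x ⬝ᵥ x = 1 ∧ (∀ k, star (u k) ⬝ᵥ x = 0) ∧
      A *ᵥ x = fun i => x i * ofDual a := by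
  set W := colMat u with hW
  set D : ℝ → Matrix ι ι DQ :=
    fun τ => diagonal fun k => ofDual (σ k - TrivSqZeroExt.inl τ) with hD
  -- All eigenvalues of the given family are moved to `τ`. An eigenvector of `B τ` whose eigenvalue
  -- has standard part other than `τ` is then orthogonal to the family, and on such a vector `B τ`
  -- and `A` agree.
  set B : ℝ → Mat n := fun τ => A - W * D τ * Wᴴ with hB
  have hBH : ∀ τ, (B τ).IsHermitian := by
    intro τ
    refine IsHermitian.sub hA (isHermitian_mul_mul_conjTranspose W ?_)
    rw [hD, IsHermitian, diagonal_conjTranspose]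
    congr 1
    ext1 k
    simp
  have hBv : ∀ τ x, B τ *ᵥ x = A *ᵥ x - W *ᵥ (D τ *ᵥ (Wᴴ *ᵥ x)) := by
    intro τ x
    simp only [hB, sub_mulVec, mulVec_mulVec, Matrix.mul_assoc]
  -- Either 0 or 1 works: if both failed, the difference `B 1 - B 0 = W Wᴴ` would have standard part
  -- `I`.
  have hτ : ∃ τ : ℝ, ∃ i j, (B τ i j).fst ≠ if i = j then (τ : ℍ[ℝ]) else 0 := by
    by_contra! hall
    obtain ⟨i, j, hij⟩ := h.exists_fst_ne hc
    apply hij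
    have e0 := hall 0 i j
    have e1 := hall 1 i j
    have e2 : B 1 = B 0 + W * Wᴴ := by
      have : D 1 = D 0 - 1 := by
        rw [hD, ← diagonal_one, diagonal_sub]
        ext1 k
        simp [ofDual_sub]
      simp only [hB, this, Matrix.mul_sub, Matrix.sub_mul, Matrix.mul_one]
      abel
    rw [e2, Matrix.add_apply, TrivSqZeroExt.fst_add, e0] at e1
    simpa using e1
  obtain ⟨τ, hτ⟩ := hτ
  obtain ⟨a, x, ha, hx, hAx⟩ := exists_eigenpair_fst_ne (hBH τ) τ hτ
  have hBu : ∀ k, B τ *ᵥ u k = fun i => u k i * ofDual (TrivSqZeroExt.inl τ) := by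
    intro k
    have e1 : Wᴴ *ᵥ u k = Pi.single k 1 := by
      ext1 j
      rw [hW, conjTranspose_colMat_mul, h j k, Pi.single_apply]
    have e2 : D τ *ᵥ Pi.single k 1 = Pi.single k (ofDual (σ k - TrivSqZeroExt.inl τ)) := by
      rw [hD, diagonal_mulVec_single, mul_one]
    rw [hBv, hσ, e1, e2]
    ext1 i
    rw [Pi.sub_apply, mulVec_single]
    simp [hW, ofDual_sub, mul_sub]
  have hort : ∀ k, star (u k) ⬝ᵥ x = 0 := fun k =>
    dotProduct_eq_zero_of_fst_ne (hBH τ) hAx (hBu k) (by simpa using ha)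
  refine ⟨a, x, hx, hort, ?_⟩
  have e1 : Wᴴ *ᵥ x = 0 := by
    ext1 k
    exact hort k
  rw [← hAx, hBv, e1, mulVec_zero, mulVec_zero, sub_zero]

/-- An orthonormal family of eigenvectors extends to an orthonormal basis of eigenvectors. -/
theorem exists_extend {A : Mat n} (hA : A.IsHermitian) (m : ℕ) (hm : m ≤ n) (u : ℕ → Vec n)
    (σ : ℕ → DualNumber ℝ)
    (hu : ∀ i < m, ∀ j < m, star (u i) ⬝ᵥ u j = if i = j then 1 else 0)
    (hσ : ∀ k < m, A *ᵥ u k = fun i => u k i * ofDual (σ k)) :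
    ∃ (v : ℕ → Vec n) (ρ : ℕ → DualNumber ℝ), (∀ k < m, v k = u k ∧ ρ k = σ k) ∧
      (∀ i < n, ∀ j < n, star (v i) ⬝ᵥ v j = if i = j then 1 else 0) ∧
      ∀ k < n, A *ᵥ v k = fun i => v k i * ofDual (ρ k) := by
  obtain ⟨d, hd⟩ := Nat.exists_eq_add_of_le hm
  induction d generalizing m u σ with
  | zero =>
    obtain rfl : n = m := hd
    exact ⟨u, σ, fun _ _ => ⟨rfl, rfl⟩, hu, hσ⟩
  | succ d ih =>
    have h1 : Orthonormal fun k : Fin m => u k := by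
      intro i j
      rw [hu i i.2 j j.2]
      simp [Fin.ext_iff]
    obtain ⟨a, x, hx, hux, hAx⟩ := h1.exists_eigenvector hA (σ := fun k => σ k)
      (fun k => hσ k k.2) (by simp; omega)
    have hux : ∀ k < m, star (u k) ⬝ᵥ x = 0 := fun k hk => hux ⟨k, hk⟩
    have ho' : ∀ i < m + 1, ∀ j < m + 1, star (Function.update u m x i) ⬝ᵥ
        Function.update u m x j = if i = j then 1 else 0 := by
      intro i hi j hj
      rcases Nat.lt_succ_iff_lt_or_eq.1 hi with hi | rfl <;>
        rcases Nat.lt_succ_iff_lt_or_eq.1 hj with hj | rfl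
      · rw [Function.update_of_ne hi.ne, Function.update_of_ne hj.ne, hu i hi j hj]
      · rw [Function.update_of_ne hi.ne, Function.update_self, hux i hi, if_neg hi.ne]
      · rw [Function.update_of_ne hj.ne, Function.update_self, star_dotProduct, hux j hj,
          if_neg hj.ne', star_zero]
      · rw [Function.update_self, hx, if_pos rfl]
    have hA' : ∀ k < m + 1, A *ᵥ Function.update u m x k =
        fun i => Function.update u m x k i * ofDual (Function.update σ m a k) := by
      intro k hk
      rcases Nat.lt_succ_iff_lt_or_eq.1 hk with hk | rfl
      · rw [Function.update_of_ne hk.ne, Function.update_of_ne hk.ne, hσ k hk]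
      · rw [Function.update_self, Function.update_self, hAx]
    obtain ⟨v, ρ, hv, hvo, hvA⟩ := ih (m + 1) (by omega) _ _ ho' hA' (by omega)
    refine ⟨v, ρ, fun k hk => ?_, hvo, hvA⟩
    have := hv k (by omega)
    rwa [Function.update_of_ne hk.ne, Function.update_of_ne hk.ne] at this

theorem mul_diagonal_of_eigen {A : Mat n} {v : Fin n → Vec n} {σ : Fin n → DualNumber ℝ}
    (h : ∀ k, A *ᵥ v k = fun i => v k i * ofDual (σ k)) :
    A * colMat v = colMat v * diagonal fun k => ofDual (σ k) := by
  ext1 i k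
  rw [mul_diagonal]
  exact congrFun (h k) i

/-- The spectral theorem for dual quaternion Hermitian matrices. -/
theorem exists_spectral {A : Mat n} (hA : A.IsHermitian) :
    ∃ (v : Fin n → Vec n) (σ : Fin n → DualNumber ℝ), Orthonormal v ∧
      ∀ k, A *ᵥ v k = fun i => v k i * ofDual (σ k) := by
  obtain ⟨v, ρ, -, hv, hA⟩ := exists_extend hA 0 (Nat.zero_le _) 0 0 (by simp) (by simp)
  refine ⟨fun k => v k, fun k => ρ k, fun i j => ?_, fun k => hA k k.2⟩
  rw [hv i i.2 j j.2]
  simp [Fin.ext_iff]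

theorem Orthonormal.mul_conjTranspose {v : Fin n → Vec n} (h : Orthonormal v) :
    colMat v * (colMat v)ᴴ = 1 := mul_eq_one_symm (orthonormal_iff.1 h)

theorem Orthonormal.expand {v : Fin n → Vec n} (h : Orthonormal v) (x : Vec n) :
    colMat v *ᵥ ((colMat v)ᴴ *ᵥ x) = x := by
  rw [mulVec_mulVec, h.mul_conjTranspose, one_mulVec]

/-- In spectral coordinates a Hermitian matrix acts by its eigenvalues. -/
theorem coord_eigen {A : Mat n} (hA : A.IsHermitian) {v : Fin n → Vec n}
    {σ : Fin n → DualNumber ℝ} (h : ∀ k, A *ᵥ v k = fun i => v k i * ofDual (σ k))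
    (x : Vec n) (k : Fin n) : star (v k) ⬝ᵥ (A *ᵥ x) = ofDual (σ k) * (star (v k) ⬝ᵥ x) := by
  have h3 : star (A *ᵥ v k) ⬝ᵥ x = star (v k) ⬝ᵥ (A *ᵥ x) := by
    rw [star_mulVec_dotProduct, hA.eq]
  rw [← h3, star_dotProduct, h, dotProduct_mul_right, star_mul, star_ofDual, ← star_dotProduct]

/-- Every eigenvalue occurs in a spectral decomposition. -/
theorem eigenvalue_mem {A : Mat n} (hA : A.IsHermitian) {v : Fin n → Vec n}
    (hv : Orthonormal v) {σ : Fin n → DualNumber ℝ}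
    (h : ∀ k, A *ᵥ v k = fun i => v k i * ofDual (σ k)) {μ : DQ} (hμ : IsEigenvalue A μ) :
    ∃ k, μ = ofDual (σ k) := by
  obtain ⟨x, hx⟩ := hμ
  obtain ⟨a, rfl⟩ := hx.exists_ofDual hA
  have h1 : ∃ k, (star (v k) ⬝ᵥ x).fst ≠ 0 := by
    by_contra! hc
    obtain ⟨i, hi⟩ := hx.1
    apply hi
    have e : x i = ∑ k, colMat v i k * (star (v k) ⬝ᵥ x) := by
      conv_lhs => rw [← hv.expand x]
      rfl
    rw [e, TrivSqZeroExt.fst_sum]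
    exact Finset.sum_eq_zero fun k _ => by rw [TrivSqZeroExt.fst_mul, hc, mul_zero]
  obtain ⟨k, hk⟩ := h1
  refine ⟨k, ?_⟩
  have h2 := coord_eigen hA h x k
  rw [hx.2, dotProduct_mul_right, ← ofDual_comm] at h2
  exact (IsAppreciable.isUnit hk).mul_right_cancel h2

theorem isEigenpair_of_unit {A : Mat n} {a : DualNumber ℝ} {x : Vec n} (hx : star x ⬝ᵥ x = 1)
    (h : A *ᵥ x = fun i => x i * ofDual a) : IsEigenpair A (ofDual a) x :=
  ⟨isAppreciableVec_of_unit hx, h⟩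

theorem Orthonormal.isEigenvalue {A : Mat n} {v : Fin n → Vec n}
    (hv : Orthonormal v) {σ : Fin n → DualNumber ℝ}
    (h : ∀ k, A *ᵥ v k = fun i => v k i * ofDual (σ k)) (k : Fin n) :
    IsEigenpair A (ofDual (σ k)) (v k) :=
  isEigenpair_of_unit (by rw [hv k k, if_pos rfl]) (h k)

theorem eq_mul_diagonal_mul {A : Mat n} {v : Fin n → Vec n} (hv : Orthonormal v)
    {σ : Fin n → DualNumber ℝ} (h : ∀ k, A *ᵥ v k = fun i => v k i * ofDual (σ k)) :
    A = colMat v * (diagonal fun k => ofDual (σ k)) * (colMat v)ᴴ := by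
  rw [← mul_diagonal_of_eigen h, Matrix.mul_assoc, hv.mul_conjTranspose, Matrix.mul_one]

theorem frobSt_eq_zero_iff {A : Mat n} : frobSt A = 0 ↔ ∀ i j, (A i j).fst = 0 := by
  rw [frobSt, Real.sqrt_eq_zero (by positivity),
    Finset.sum_eq_zero_iff_of_nonneg (fun _ _ => by positivity)]
  simp only [Finset.sum_eq_zero_iff_of_nonneg (fun _ _ => sq_nonneg _)]
  simp

/-- If all eigenvalues are infinitesimal, the standard part of the matrix vanishes. -/
theorem fst_eq_zero_of_forall {A : Mat n} {v : Fin n → Vec n} (hv : Orthonormal v)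
    {σ : Fin n → DualNumber ℝ} (h : ∀ k, A *ᵥ v k = fun i => v k i * ofDual (σ k))
    (h0 : ∀ k, (σ k).fst = 0) (i j : Fin n) : (A i j).fst = 0 := by
  rw [eq_mul_diagonal_mul hv h, mul_apply, TrivSqZeroExt.fst_sum]
  refine Finset.sum_eq_zero fun k _ => ?_
  rw [mul_diagonal]
  simp [h0]

/-- The standard part of an eigenvalue is bounded by the Frobenius norm. -/
theorem norm_fst_le_frobSt {A : Mat n} {a : DualNumber ℝ} {x : Vec n} (hx : star x ⬝ᵥ x = 1)
    (h : A *ᵥ x = fun i => x i * ofDual a) : |a.fst| ≤ frobSt A := by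
  have h1 : ∑ i, ‖(x i).fst‖ ^ 2 = 1 := by
    rw [← ofDual_vnsq, ← ofDual_one, ofDual_injective.eq_iff] at hx
    rw [← fst_vnsq, hx, TrivSqZeroExt.fst_one]
  have h2 : ∀ i, ‖(x i).fst‖ ^ 2 * |a.fst| ^ 2 ≤ ∑ j, ‖(A i j).fst‖ ^ 2 := by
    intro i
    have e := congrArg TrivSqZeroExt.fst (congrFun h i)
    simp only [mulVec, dotProduct, TrivSqZeroExt.fst_sum, TrivSqZeroExt.fst_mul] at e
    have e2 : ‖(x i).fst‖ * |a.fst| = ‖∑ j, (A i j).fst * (x j).fst‖ := by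
      rw [e, norm_mul, norm_fst_ofDual]
    rw [← mul_pow, e2]
    calc _ ≤ (∑ j, ‖(A i j).fst‖ * ‖(x j).fst‖) ^ 2 := by
          gcongr
          exact (norm_sum_le _ _).trans_eq (by simp only [norm_mul])
      _ ≤ (∑ j, ‖(A i j).fst‖ ^ 2) * ∑ j, ‖(x j).fst‖ ^ 2 := Finset.sum_mul_sq_le_sq_mul_sq _ _ _
      _ = _ := by rw [h1, mul_one]
  rw [frobSt]
  apply Real.le_sqrt_of_sq_le
  rw [← one_mul (|a.fst| ^ 2), ← h1, Finset.sum_mul]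
  exact Finset.sum_le_sum fun i _ => h2 i

end

section

/-! ### The Rayleigh quotient iteration returns eigenpairs -/

variable {n : ℕ}

instance : ContinuousStar DQ where
  continuous_star := by
    have : (star : DQ → DQ) = fun q =>
        TrivSqZeroExt.inl (star q.fst) + TrivSqZeroExt.inr (star q.snd) := rfl
    rw [this]
    exact (TrivSqZeroExt.continuous_inl.comp TrivSqZeroExt.continuous_fst.star).add
      (TrivSqZeroExt.continuous_inr.comp TrivSqZeroExt.continuous_snd.star)

theorem real_smul_eq (s : ℝ) (q : DQ) : s • q = q * ofDual (TrivSqZeroExt.inl s) := by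
  apply TrivSqZeroExt.ext <;> simp [Quaternion.mul_coe_eq_smul]

theorem IsRQIStep.unit {A : Mat n} {u u' : Vec n} (h : IsRQIStep A u u')
    (hu : star u ⬝ᵥ u = 1) :
    star u' ⬝ᵥ u' = 1 ∧ ∃ b, shifted A u *ᵥ u' = fun i => u i * ofDual b := by
  obtain ⟨-, w, hw, rfl⟩ := h
  have hwa : IsAppreciableVec w := by
    by_contra hc
    simp only [IsAppreciableVec, not_exists, not_not] at hc
    obtain ⟨i, hi⟩ := isAppreciableVec_of_unit hu
    apply hi
    rw [← hw]
    simp [mulVec, dotProduct, TrivSqZeroExt.fst_sum, hc]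
  have hpos := fst_vnsq_pos_iff.2 hwa
  refine ⟨?_, (norm₂ w)⁻¹, by rw [mulVec_mul_right, hw]⟩
  rw [← ofDual_vnsq, vnsq_mul_ofDual, norm₂_eq hwa, ← ofDual_one]
  congr 1
  have h1 := TrivSqZeroExt.mul_inv_cancel (fst_dualSqrt_pos hpos).ne'
  nth_rewrite 1 [← dualSqrt_sq hpos]
  rw [← mul_pow, h1, one_pow]

theorem rayleigh_smul_sign (A : Mat n) (u : Vec n) {s : ℝ} (hs : s = 1 ∨ s = -1) :
    rayleigh A (s • u) = rayleigh A u := by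
  rcases hs with rfl | rfl <;> simp [rayleigh, mulVec_neg]

theorem star_smul_sign (u : Vec n) {s : ℝ} (hs : s = 1 ∨ s = -1) :
    star (s • u) ⬝ᵥ (s • u) = star u ⬝ᵥ u := by
  rcases hs with rfl | rfl <;> simp

theorem continuous_rayleigh (A : Mat n) : Continuous (rayleigh A) :=
  continuous_star.dotProduct (continuous_const.matrix_mulVec continuous_id)

theorem tendsto_star_dotProduct {α : Type*} {l : Filter α} {f g : α → Vec n} {x y : Vec n}
    (hf : Tendsto f l (𝓝 x)) (hg : Tendsto g l (𝓝 y)) :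
    Tendsto (fun k => star (f k) ⬝ᵥ g k) l (𝓝 (star x ⬝ᵥ y)) := by
  rw [tendsto_pi_nhds] at hf hg
  exact tendsto_finsetSum _ fun i _ => (hf i).star.mul (hg i)

/-- In the infinite case no rate of convergence is needed. The residual `R k = (A - θ_k) y (k + 1)`
equals `y k` times a dual number `c k`, and `c k = y_k* R k` tends to `x* (A x - μ x) = 0` because
`μ` is the Rayleigh quotient of the limit `x`. So the limit `A x - μ x` of the residuals is zero. -/
theorem RQIReturns.eigen {A : Mat n} (hA : A.IsHermitian) {u₀ : Vec n} {μ : DQ} {x : Vec n}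
    (h : RQIReturns A u₀ μ x) :
    ∃ a, μ = ofDual a ∧ star x ⬝ᵥ x = 1 ∧ A *ᵥ x = fun i => x i * ofDual a := by
  obtain ⟨h0, u, rfl, ⟨N, -, -, hx, hAx, rfl⟩ | ⟨hstep, hθ, s, hs, hlim⟩⟩ := h
  · obtain ⟨a, ha⟩ := rayleigh_real hA (u N)
    refine ⟨a, ha, norm₂_eq_one_iff.1 hx, ?_⟩
    rw [shifted_mulVec ha] at hAx
    ext1 i
    exact sub_eq_zero.1 (congrFun hAx i)
  · have hu : ∀ k, star (u k) ⬝ᵥ u k = 1 := by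
      intro k
      induction k with
      | zero => exact norm₂_eq_one_iff.1 h0
      | succ k ih => exact ((hstep k).unit ih).1
    have hx : star x ⬝ᵥ x = 1 := by
      have hc : Continuous fun y : Vec n => star y ⬝ᵥ y := continuous_star.dotProduct continuous_id
      refine tendsto_nhds_unique ((hc.tendsto x).comp hlim) ?_
      simp only [Function.comp_def, star_smul_sign _ (hs _), hu]
      exact tendsto_const_nhds
    have hμ : rayleigh A x = μ := by
      refine tendsto_nhds_unique (((continuous_rayleigh A).tendsto x).comp hlim) ?_
      simpa only [Function.comp_def, rayleigh_smul_sign _ _ (hs _)] using hθ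
    obtain ⟨a, ha⟩ := rayleigh_real hA x
    refine ⟨a, hμ ▸ ha, hx, ?_⟩
    set y : ℕ → Vec n := fun k => s k • u k with hy
    set R : ℕ → Vec n := fun k => A *ᵥ y (k + 1) - rayleigh A (u k) • y (k + 1) with hR
    have hR1 : ∀ k, ∃ c, R k = fun i => y k i * ofDual c := by
      intro k
      obtain ⟨b, hb⟩ := ((hstep k).unit (hu k)).2
      refine ⟨TrivSqZeroExt.inl (s k) * b * TrivSqZeroExt.inl (s (k + 1)), ?_⟩
      have e1 : R k = shifted A (u k) *ᵥ y (k + 1) := by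
        rw [shifted, sub_mulVec, smul_mulVec, one_mulVec]
      have e2 : y (k + 1) = fun i => u (k + 1) i * ofDual (TrivSqZeroExt.inl (s (k + 1))) := by
        ext1 i
        exact real_smul_eq _ _
      have e3 : ofDual (TrivSqZeroExt.inl (s k)) * ofDual (TrivSqZeroExt.inl (s k)) = 1 := by
        rw [← ofDual_mul, ← TrivSqZeroExt.inl_mul]
        rcases hs k with h | h <;> simp [h]
      rw [e1, e2, mulVec_mul_right, hb]
      ext1 i
      simp only [hy, Pi.smul_apply, real_smul_eq, ofDual_mul, ← mul_assoc]
      rw [mul_assoc (u k i) (ofDual (TrivSqZeroExt.inl (s k))) (ofDual (TrivSqZeroExt.inl (s k))), e3,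
        mul_one, mul_assoc]
    choose c hc using hR1
    have hRlim : Tendsto R atTop (𝓝 (A *ᵥ x - μ • x)) := by
      have h1 : Tendsto (fun k => y (k + 1)) atTop (𝓝 x) := hlim.comp (tendsto_add_atTop_nat 1)
      have h2 : Continuous fun z : Vec n => A *ᵥ z := continuous_const.matrix_mulVec continuous_id
      refine ((h2.tendsto x).comp h1).sub ?_
      rw [tendsto_pi_nhds]
      intro i
      exact hθ.mul (((continuous_apply i).tendsto x).comp h1)
    have hclim : Tendsto (fun k => ofDual (c k)) atTop (𝓝 0) := by
      have h1 : (fun k => ofDual (c k)) = fun k => star (y k) ⬝ᵥ R k := by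
        ext1 k
        rw [hc, dotProduct_mul_right, hy, star_smul_sign _ (hs k), hu, one_mul]
      have h2 : star x ⬝ᵥ (A *ᵥ x - μ • x) = 0 := by
        rw [dotProduct_sub, ← rayleigh, hμ, ← hμ, ha, ofDual_smul_vec, dotProduct_mul_right, hx,
          one_mul, sub_self]
      rw [h1, ← h2]
      exact tendsto_star_dotProduct hlim hRlim
    have hfin : A *ᵥ x - μ • x = 0 := by
      refine tendsto_nhds_unique hRlim ?_
      rw [tendsto_pi_nhds]
      intro i
      have := (((continuous_apply i).tendsto x).comp hlim).mul hclim
      rw [mul_zero] at this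
      simpa only [hc, Function.comp_def, Pi.zero_apply] using this
    rw [sub_eq_zero.1 hfin, ← hμ, ha, ofDual_smul_vec]

/-! ### Deflation -/

theorem deflate_succ_mulVec (A : Mat n) (lam : ℕ → DQ) (u : ℕ → Vec n) (k : ℕ) (x : Vec n) :
    deflate A lam u (k + 1) *ᵥ x =
      deflate A lam u k *ᵥ x - lam k • fun i => u k i * (star (u k) ⬝ᵥ x) := by
  rw [deflate, sub_mulVec, smul_mulVec]
  congr 2
  ext1 i
  simp [mulVec, dotProduct, vecMulVec, Finset.mul_sum, mul_assoc]

/-- In the first `K` rounds of the deflation, unit eigenpairs of the current matrices have been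
split off, with dual numbers `a k` as eigenvalues. -/
def IsDeflation (A : Mat n) (K : ℕ) (lam : ℕ → DQ) (u : ℕ → Vec n) (a : ℕ → DualNumber ℝ) : Prop :=
  ∀ k < K, lam k = ofDual (a k) ∧ star (u k) ⬝ᵥ u k = 1 ∧
    deflate A lam u k *ᵥ u k = fun i => u k i * ofDual (a k)

variable {A : Mat n} {K : ℕ} {lam : ℕ → DQ} {u : ℕ → Vec n} {a : ℕ → DualNumber ℝ}

theorem deflate_isHermitian (hA : A.IsHermitian) (h : ∀ k < K, ∃ b, lam k = ofDual b) :
    (deflate A lam u K).IsHermitian := by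
  induction K with
  | zero => exact hA
  | succ k ih =>
    refine (ih fun j hj => h j (by omega)).sub ?_
    obtain ⟨b, hb⟩ := h k (by omega)
    rw [hb, IsHermitian]
    ext1 i j
    simp only [conjTranspose_apply, Matrix.smul_apply, vecMulVec_apply, smul_eq_mul, star_mul,
      star_ofDual, Pi.star_apply, star_star]
    rw [ofDual_comm]

/-- One induction serves two facts: the current matrix is Hermitian because the earlier eigenvalues
are dual numbers, and the next eigenvalue is a dual number because the matrix is Hermitian. -/
theorem IsRun.exists_isDeflation (hA : A.IsHermitian) {γ : ℝ} (h : IsRun A γ K lam u) :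
    ∃ a, IsDeflation A K lam u a := by
  have h1 : ∀ m ≤ K, ∀ k < m, ∃ b, lam k = ofDual b ∧ star (u k) ⬝ᵥ u k = 1 ∧
      deflate A lam u k *ᵥ u k = fun i => u k i * ofDual b := by
    intro m
    induction m with
    | zero => simp
    | succ m ih =>
      intro hm k hk
      rcases Nat.lt_succ_iff_lt_or_eq.1 hk with hk | rfl
      · exact ih (by omega) k hk
      · obtain ⟨u₀, hu⟩ := h.1 k (by omega)
        refine hu.eigen (deflate_isHermitian hA fun j hj => ?_)
        obtain ⟨b, hb, -⟩ := ih (by omega) j hj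
        exact ⟨b, hb⟩
  have h2 : ∀ k, ∃ b, k < K → lam k = ofDual b ∧ star (u k) ⬝ᵥ u k = 1 ∧
      deflate A lam u k *ᵥ u k = fun i => u k i * ofDual b := by
    intro k
    by_cases hk : k < K
    · obtain ⟨b, hb⟩ := h1 K le_rfl k hk
      exact ⟨b, fun _ => hb⟩
    · exact ⟨0, fun h => absurd h hk⟩
  choose a ha using h2
  exact ⟨a, ha⟩

theorem IsDeflation.isHermitian (hA : A.IsHermitian) (h : IsDeflation A K lam u a) {k : ℕ}
    (hk : k ≤ K) : (deflate A lam u k).IsHermitian :=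
  deflate_isHermitian hA fun j hj => ⟨a j, (h j (by omega)).1⟩

/-- Appreciable eigenpairs of a deflated matrix are eigenpairs of the original one, and orthogonal
to all vectors split off before. -/
theorem IsDeflation.eigen_of_deflate (hA : A.IsHermitian) (h : IsDeflation A K lam u a)
    {b : DualNumber ℝ} (hb : b.fst ≠ 0) {y : Vec n} {k : ℕ} (hk : k ≤ K)
    (hy : deflate A lam u k *ᵥ y = fun i => y i * ofDual b) :
    A *ᵥ y = (fun i => y i * ofDual b) ∧ ∀ j < k, star (u j) ⬝ᵥ y = 0 := by
  induction k with
  | zero => exact ⟨hy, by simp⟩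
  | succ k ih =>
    obtain ⟨h1, h2, h3⟩ := h k (by omega)
    -- The split-off vector now has eigenvalue 0, while `b` is appreciable. So `y` is orthogonal to
    -- it and the rank-one correction vanishes on `y`.
    have h4 : deflate A lam u (k + 1) *ᵥ u k = fun i => u k i * ofDual 0 := by
      rw [deflate_succ_mulVec, h3, h2, h1, ofDual_smul_vec]
      ext1 i
      simp
    have h5 : star (u k) ⬝ᵥ y = 0 :=
      dotProduct_eq_zero_of_fst_ne (h.isHermitian hA hk) hy h4 (by simpa using hb)
    have h6 : deflate A lam u k *ᵥ y = fun i => y i * ofDual b := by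
      rw [← hy, deflate_succ_mulVec, h5]
      ext1 i
      simp
    obtain ⟨h7, h8⟩ := ih (by omega) h6
    refine ⟨h7, fun j hj => ?_⟩
    rcases Nat.lt_succ_iff_lt_or_eq.1 hj with hj | rfl
    · exact h8 j hj
    · exact h5

theorem IsDeflation.appreciable (h : IsDeflation A K lam u a) {k : ℕ} (hk : k < K) :
    IsAppreciable (lam k) ↔ (a k).fst ≠ 0 := by
  rw [(h k hk).1, isAppreciable_ofDual]

theorem IsDeflation.eigen (hA : A.IsHermitian) (h : IsDeflation A K lam u a) {k : ℕ} (hk : k < K)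
    (ha : IsAppreciable (lam k)) : A *ᵥ u k = fun i => u k i * ofDual (a k) :=
  (h.eigen_of_deflate hA ((h.appreciable hk).1 ha) hk.le (h k hk).2.2).1

theorem IsDeflation.dotProduct_eq_zero (hA : A.IsHermitian) (h : IsDeflation A K lam u a)
    {j k : ℕ} (hj : j < K) (hk : k < K) (hjk : j ≠ k) (haj : IsAppreciable (lam j))
    (hak : IsAppreciable (lam k)) : star (u j) ⬝ᵥ u k = 0 := by
  rcases lt_or_gt_of_ne hjk with h1 | h1
  · exact (h.eigen_of_deflate hA ((h.appreciable hk).1 hak) hk.le (h k hk).2.2).2 j h1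
  · rw [star_dotProduct,
      (h.eigen_of_deflate hA ((h.appreciable hj).1 haj) hj.le (h j hj).2.2).2 k h1, star_zero]

theorem IsDeflation.orthonormal (hA : A.IsHermitian) (h : IsDeflation A K lam u a) :
    Orthonormal fun k : {k : ℕ // k < K ∧ IsAppreciable (lam k)} => u k := by
  intro i j
  split_ifs with hij
  · rw [hij, (h j j.2.1).2.1]
  · exact h.dotProduct_eq_zero hA i.2.1 j.2.1 (fun hc => hij (Subtype.ext hc)) i.2.2 j.2.2

theorem finite_appreciable (K : ℕ) (lam : ℕ → DQ) :
    {k : ℕ | k < K ∧ IsAppreciable (lam k)}.Finite :=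
  (Set.finite_lt_nat K).subset fun _ hk => hk.1

theorem IsDeflation.ncard_le (hA : A.IsHermitian) (h : IsDeflation A K lam u a) :
    {k | k < K ∧ IsAppreciable (lam k)}.ncard ≤ n := by
  have : Fintype {k : ℕ // k < K ∧ IsAppreciable (lam k)} := (finite_appreciable K lam).fintype
  rw [← Nat.card_coe_set_eq]
  exact (Nat.card_eq_fintype_card (α := {k : ℕ // k < K ∧ IsAppreciable (lam k)})).trans_le
    (h.orthonormal hA).card_le

/-- Rounds with an infinitesimal `lam j` change only the dual part of the matrix, so orthogonality
is needed only for the appreciable rounds. -/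
theorem fst_deflate_mulVec {y : Vec n} {k : ℕ}
    (hy : ∀ j < k, IsAppreciable (lam j) → star (u j) ⬝ᵥ y = 0) (i : Fin n) :
    ((deflate A lam u k *ᵥ y) i).fst = ((A *ᵥ y) i).fst := by
  induction k with
  | zero => rfl
  | succ k ih =>
    rw [deflate_succ_mulVec, Pi.sub_apply, TrivSqZeroExt.fst_sub,
      ih fun j hj => hy j (by omega)]
    by_cases ha : IsAppreciable (lam k)
    · simp [hy k (by omega) ha]
    · simp [not_not.1 ha]

/-- When the Frobenius norm of the standard part has dropped to a level below all appreciable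
eigenvalues, the standard part vanishes. -/
theorem IsDeflation.fst_eq_zero (hA : A.IsHermitian) (h : IsDeflation A K lam u a) {γ : ℝ}
    (hγ : ∀ μ, IsAppreciable μ → IsEigenvalue A μ → γ < ‖μ.fst‖)
    (hK : frobSt (deflate A lam u K) ≤ γ) (i j : Fin n) : (deflate A lam u K i j).fst = 0 := by
  obtain ⟨v, σ, hv, hσ⟩ := exists_spectral (h.isHermitian hA le_rfl)
  refine fst_eq_zero_of_forall hv hσ (fun k => ?_) i j
  by_contra hk
  have h1 : star (v k) ⬝ᵥ v k = 1 := by rw [hv k k, if_pos rfl]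
  have h2 := hγ (ofDual (σ k)) (isAppreciable_ofDual.2 hk)
    ⟨v k, isEigenpair_of_unit h1 (h.eigen_of_deflate hA hk le_rfl (hσ k)).1⟩
  rw [norm_fst_ofDual] at h2
  linarith [norm_fst_le_frobSt h1 (hσ k)]

/-- The unitary decomposition produced by a deflation that has stopped. -/
theorem IsDeflation.exists_unitary (hA : A.IsHermitian) (h : IsDeflation A K lam u a)
    (h0 : ∀ i j, (deflate A lam u K i j).fst = 0) :
    ∃ (v : Fin n → Vec n) (σ : Fin n → DualNumber ℝ), Orthonormal v ∧
      (∀ k, A *ᵥ v k = fun i => v k i * ofDual (σ k)) ∧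
      ∃ e : {k : ℕ // k < K ∧ IsAppreciable (lam k)} ≃ {i : Fin n // (σ i).fst ≠ 0},
        ∀ k, lam k.1 = ofDual (σ (e k).1) ∧ v (e k).1 = u k.1 := by
  have : Fintype {k : ℕ // k < K ∧ IsAppreciable (lam k)} := (finite_appreciable K lam).fintype
  set S := {k : ℕ // k < K ∧ IsAppreciable (lam k)} with hS
  set m := Fintype.card S with hm
  have ho := h.orthonormal hA
  have hmn : m ≤ n := ho.card_le
  let f : Fin m ≃ S := (Fintype.equivFin S).symm
  obtain ⟨v, ρ, hv, hvo, hvA⟩ := exists_extend hA m hmn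
    (fun k => if hk : k < m then u (f ⟨k, hk⟩) else 0)
    (fun k => if hk : k < m then a (f ⟨k, hk⟩) else 0)
    (by
      intro i hi j hj
      rw [dif_pos hi, dif_pos hj]
      refine (ho (f ⟨i, hi⟩) (f ⟨j, hj⟩)).trans ?_
      simp)
    (by
      intro k hk
      rw [dif_pos hk, dif_pos hk]
      exact h.eigen hA (f ⟨k, hk⟩).2.1 (f ⟨k, hk⟩).2.2)
  have hvu : ∀ k : Fin m, v k = u (f k) := fun k => by rw [(hv k k.2).1, dif_pos k.2]
  have hρa : ∀ k : Fin m, ρ k = a (f k) := fun k => by rw [(hv k k.2).2, dif_pos k.2]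
  have hne : ∀ k : Fin m, (ρ k).fst ≠ 0 := fun k => by
    rw [hρa, ← h.appreciable (f k).2.1]
    exact (f k).2.2
  -- An added basis vector is orthogonal to all appreciable outputs, so on it `A` and the final
  -- deflated matrix have the same standard part, which is 0.
  have hzero : ∀ k < n, m ≤ k → (ρ k).fst = 0 := by
    intro k hk hmk
    have h1 : ∀ j < K, IsAppreciable (lam j) → star (u j) ⬝ᵥ v k = 0 := by
      intro j hj haj
      have e : u j = v (f.symm ⟨j, hj, haj⟩) := by
        rw [hvu, Equiv.apply_symm_apply]
      have hlt := (f.symm ⟨j, hj, haj⟩).2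
      rw [e, hvo _ (by omega) _ hk, if_neg (by omega)]
    obtain ⟨i, hi⟩ := isAppreciableVec_of_unit (x := v k) (by rw [hvo k hk k hk, if_pos rfl])
    have h2 := fst_deflate_mulVec (A := A) h1 i
    rw [hvA k hk, TrivSqZeroExt.fst_mul] at h2
    have h3 : ((deflate A lam u K *ᵥ v k) i).fst = 0 := by
      simp [mulVec, dotProduct, TrivSqZeroExt.fst_sum, h0]
    rw [h3] at h2
    have h4 := (mul_eq_zero.1 h2.symm).resolve_left hi
    by_contra hc
    exact isAppreciable_ofDual.2 hc h4
  let g : Fin m → {i : Fin n // (ρ i).fst ≠ 0} := fun k => ⟨⟨k, by omega⟩, hne k⟩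
  have hg : Function.Bijective g := by
    constructor
    · intro i j hij
      have := congrArg (fun t => (t.1 : ℕ)) hij
      exact Fin.ext this
    · rintro ⟨i, hi⟩
      have him : (i : ℕ) < m := by
        by_contra hc
        exact hi (hzero i i.2 (by omega))
      exact ⟨⟨i, him⟩, rfl⟩
  refine ⟨fun k => v k, fun k => ρ k, fun i j => ?_, fun k => hvA k k.2,
    f.symm.trans (Equiv.ofBijective g hg), fun k => ?_⟩
  · rw [hvo i i.2 j j.2]
    simp [Fin.ext_iff]
  · have e1 := hvu (f.symm k)
    have e2 := hρa (f.symm k)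
    rw [Equiv.apply_symm_apply] at e1 e2
    refine ⟨?_, e1⟩
    rw [(h k k.2.1).1, ← e2]
    rfl

end

section

/-! ### The dynamics of the Rayleigh quotient iteration in spectral coordinates -/

/-! ### Landau calculus for sequences of dual numbers. -/

section Asymptotics

open Asymptotics

/-- A sequence of dual numbers with standard part `o(1)` and dual part `o(g)`. -/
def DSmall (g : ℕ → ℝ) (z : ℕ → DualNumber ℝ) : Prop :=
  (fun k => (z k).fst) =o[atTop] (fun _ => (1 : ℝ)) ∧ (fun k => (z k).snd) =o[atTop] g

/-- A sequence of dual numbers with standard part `O(1)` and dual part `O(g)`. -/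
def DBdd (g : ℕ → ℝ) (z : ℕ → DualNumber ℝ) : Prop :=
  (fun k => (z k).fst) =O[atTop] (fun _ => (1 : ℝ)) ∧ (fun k => (z k).snd) =O[atTop] g

variable {g : ℕ → ℝ} {z w : ℕ → DualNumber ℝ}

theorem DSmall.bdd (h : DSmall g z) : DBdd g z := ⟨h.1.isBigO, h.2.isBigO⟩

theorem DBdd.add (hz : DBdd g z) (hw : DBdd g w) : DBdd g fun k => z k + w k :=
  ⟨hz.1.add hw.1, hz.2.add hw.2⟩

theorem DSmall.neg (hz : DSmall g z) : DSmall g fun k => -z k :=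
  ⟨hz.1.neg_left, hz.2.neg_left⟩

theorem DBdd.mul_small (hz : DBdd g z) (hw : DSmall g w) : DSmall g fun k => z k * w k := by
  constructor
  · simpa using hz.1.mul_isLittleO hw.1
  · have h1 := hz.1.mul_isLittleO hw.2
    have h2 := hw.1.mul_isBigO hz.2
    simp only [one_mul] at h1 h2
    refine (h1.add h2).congr_left fun k => ?_
    simp [mul_comm]

theorem DBdd.const (hg : (fun _ => (1 : ℝ)) =O[atTop] g) (c : DualNumber ℝ) :
    DBdd g fun _ => c :=
  ⟨isBigO_const_const _ one_ne_zero _, (isBigO_const_const _ one_ne_zero _).trans hg⟩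

theorem DSmall.sum {ι : Type*} (s : Finset ι) {f : ι → ℕ → DualNumber ℝ}
    (h : ∀ i ∈ s, DSmall g (f i)) : DSmall g fun k => ∑ i ∈ s, f i k := by
  constructor
  · simp only [TrivSqZeroExt.fst_sum]
    exact IsLittleO.fun_sum fun i hi => (h i hi).1
  · simp only [TrivSqZeroExt.snd_sum]
    exact IsLittleO.fun_sum fun i hi => (h i hi).2

theorem DBdd.sum {ι : Type*} (s : Finset ι) {f : ι → ℕ → DualNumber ℝ}
    (h : ∀ i ∈ s, DBdd g (f i)) : DBdd g fun k => ∑ i ∈ s, f i k := by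
  constructor
  · simp only [TrivSqZeroExt.fst_sum]
    exact IsBigO.fun_sum fun i hi => (h i hi).1
  · simp only [TrivSqZeroExt.snd_sum]
    exact IsBigO.fun_sum fun i hi => (h i hi).2

theorem DBdd.inv (hz : DBdd g z) {c : ℝ} (hc : 0 < c) (h : ∀ k, c ≤ |(z k).fst|) :
    DBdd g fun k => (z k)⁻¹ := by
  have h1 : (fun k => ((z k).fst)⁻¹) =O[atTop] (fun _ => (1 : ℝ)) := by
    refine IsBigO.of_bound c⁻¹ (Eventually.of_forall fun k => ?_)
    rw [norm_inv, Real.norm_eq_abs, norm_one, mul_one]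
    exact inv_anti₀ hc (h k)
  refine ⟨by simpa using h1, ?_⟩
  have h2 := ((h1.mul h1).mul hz.2).neg_left
  refine IsBigO.congr h2 (fun k => ?_) (fun k => ?_)
  · simp
    ring
  · simp

/-- The dual part of `z ^ 2` is `2 z_st z_I`, an `o(1)` times an `O(g)`. This gain is what makes the
dual parts converge. -/
theorem DSmall.sq_of_bdd (h1 : (fun k => (z k).fst) =o[atTop] (fun _ => (1 : ℝ)))
    (h2 : (fun k => (z k).snd) =O[atTop] g) : DSmall g fun k => z k ^ 2 := by
  constructor
  · simpa [sq] using h1.mul h1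
  · have h3 := h1.mul_isBigO h2
    simp only [one_mul] at h3
    refine IsLittleO.congr (h3.add h3) (fun k => ?_) (fun k => rfl)
    simp [sq, mul_comm]

theorem DSmall.tendsto (h : DSmall g z) (hg : g =O[atTop] (fun _ => (1 : ℝ))) :
    Tendsto z atTop (𝓝 0) := by
  have h1 := (isLittleO_one_iff ℝ).1 h.1
  have h2 := (isLittleO_one_iff ℝ).1 (h.2.trans_isBigO hg)
  have h3 := (TrivSqZeroExt.continuous_inl (M := ℝ)).continuousAt.tendsto.comp h1
  have h4 := (TrivSqZeroExt.continuous_inr (R := ℝ)).continuousAt.tendsto.comp h2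
  have h5 := h3.add h4
  simp only [TrivSqZeroExt.inl_zero, TrivSqZeroExt.inr_zero, add_zero] at h5
  refine h5.congr fun k => ?_
  exact TrivSqZeroExt.inl_fst_add_inr_snd_eq (z k)

/-- Once `d (k + 1) ≤ (1 + d k) / 2`, the bound `max (d N) 1` reproduces itself. -/
theorem isBigO_one_of_succ_isLittleO {d : ℕ → ℝ} (hd : ∀ k, 0 ≤ d k)
    (h : (fun k => d (k + 1)) =o[atTop] (fun k => 1 + d k)) :
    d =O[atTop] (fun _ => (1 : ℝ)) := by
  obtain ⟨N, hN⟩ := eventually_atTop.1 (h.bound (c := 1 / 2) (by norm_num))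
  refine IsBigO.of_bound (max (d N) 1) (eventually_atTop.2 ⟨N, fun k hk => ?_⟩)
  rw [norm_one, mul_one, Real.norm_of_nonneg (hd k)]
  induction k, hk using Nat.le_induction with
  | base => exact le_max_left _ _
  | succ k hk ih =>
    have h1 := hN k hk
    rw [Real.norm_of_nonneg (hd _), Real.norm_of_nonneg (by linarith [hd k])] at h1
    linarith [le_max_right (d N) 1]

end Asymptotics

/-! ### The recursion for the coordinate factors. -/

variable {ι : Type*} [Fintype ι]

/-- The squared norm of the vector whose coordinates have the squared magnitudes
`a i * Q i ^ 2`. -/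
def rqDen (a Q : ι → DualNumber ℝ) : DualNumber ℝ := ∑ i, a i * Q i ^ 2

/-- The difference between the Rayleigh quotient and the eigenvalue, when the eigenvalues differ
from it by `d i`. -/
def rqErr (d a Q : ι → DualNumber ℝ) : DualNumber ℝ := (∑ i, d i * a i * Q i ^ 2) * (rqDen a Q)⁻¹

open Classical in
/-- One step of the Rayleigh quotient iteration, normalized to preserve the coordinates in the
eigenspace. -/
def rqStep (d a Q : ι → DualNumber ℝ) (i : ι) : DualNumber ℝ :=
  -- Solving with the shift divides coordinate `i` by `d i - e`; rescaling by `-e` gives the factor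
  -- 1 where `d i = 0`. The factor 1 is also right for infinitesimal `d i`, provided that `d i`
  -- annihilates the coordinate.
  if (d i).fst = 0 then Q i else Q i * (-rqErr d a Q * (d i - rqErr d a Q)⁻¹)

/-- The coordinate factors after `k` steps. -/
def rqSeq (d a : ι → DualNumber ℝ) (k : ℕ) : ι → DualNumber ℝ := (rqStep d a)^[k] 1

variable {d a : ι → DualNumber ℝ}

theorem rqSeq_zero : rqSeq d a 0 = 1 := rfl

theorem rqSeq_succ (k : ℕ) : rqSeq d a (k + 1) = rqStep d a (rqSeq d a k) :=
  Function.iterate_succ_apply' _ _ _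

theorem rqSeq_of_fst_eq_zero {i : ι} (hi : (d i).fst = 0) (k : ℕ) : rqSeq d a k i = 1 := by
  induction k with
  | zero => rfl
  | succ k ih => rw [rqSeq_succ, rqStep, if_pos hi, ih]

open Classical in
/-- The coordinates outside the eigenspace are small, the eigenvalue is extremal. -/
structure RQHyp (d a : ι → DualNumber ℝ) (g A₁ : ℝ) : Prop where
  nonneg : ∀ i, 0 ≤ (a i).fst
  mul_eq_zero : ∀ i, (d i).fst = 0 → d i * a i = 0
  g_pos : 0 < g
  gap : ∀ i, (d i).fst ≠ 0 → g ≤ |(d i).fst|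
  A_pos : 0 < A₁
  A_eq : A₁ = ∑ i, if (d i).fst = 0 then (a i).fst else 0
  -- With `A₁` bounding the denominator from below, this keeps the standard part of the error within
  -- a third of the gap.
  small : ∑ i, |(d i).fst| * (a i).fst ≤ g / 3 * A₁
  -- Equal signs exclude cancellation in the numerator of the error. With `exists_ne` the error
  -- therefore never has standard part 0, and every shift is nonsingular.
  sign : (∀ i, 0 ≤ (d i).fst) ∨ ∀ i, (d i).fst ≤ 0
  exists_ne : ∃ i, (d i).fst ≠ 0 ∧ (a i).fst ≠ 0

variable {g A₁ : ℝ}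

theorem RQHyp.le_fst_rqDen (h : RQHyp d a g A₁) {Q : ι → DualNumber ℝ}
    (hQ : ∀ i, (d i).fst = 0 → Q i = 1) : A₁ ≤ (rqDen a Q).fst := by
  rw [h.A_eq, rqDen, TrivSqZeroExt.fst_sum]
  refine Finset.sum_le_sum fun i _ => ?_
  rw [TrivSqZeroExt.fst_mul, TrivSqZeroExt.fst_pow]
  split_ifs with hi
  · simp [hQ i hi]
  · exact mul_nonneg (h.nonneg i) (sq_nonneg _)

theorem fst_rqErr (Q : ι → DualNumber ℝ) :
    (rqErr d a Q).fst = (∑ i, (d i).fst * (a i).fst * (Q i).fst ^ 2) / (rqDen a Q).fst := by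
  simp [rqErr, TrivSqZeroExt.fst_sum, div_eq_mul_inv]

theorem RQHyp.abs_fst_rqErr_le (h : RQHyp d a g A₁) {Q : ι → DualNumber ℝ}
    (hQ : ∀ i, (d i).fst = 0 → Q i = 1) {r : ℝ}
    (hr : ∀ i, (d i).fst ≠ 0 → |(Q i).fst| ≤ r) : |(rqErr d a Q).fst| ≤ g / 3 * r ^ 2 := by
  have h1 := h.le_fst_rqDen hQ
  have h2 : |∑ i, (d i).fst * (a i).fst * (Q i).fst ^ 2| ≤ g / 3 * A₁ * r ^ 2 := by
    calc _ ≤ ∑ i, |(d i).fst * (a i).fst * (Q i).fst ^ 2| := Finset.abs_sum_le_sum_abs _ _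
      _ ≤ ∑ i, |(d i).fst| * (a i).fst * r ^ 2 := by
          refine Finset.sum_le_sum fun i _ => ?_
          rw [abs_mul, abs_mul, abs_of_nonneg (h.nonneg i), abs_pow]
          by_cases hi : (d i).fst = 0
          · simp [hi]
          · have := hr i hi
            have := h.nonneg i
            gcongr
      _ ≤ _ := by
          rw [← Finset.sum_mul]
          exact mul_le_mul_of_nonneg_right h.small (sq_nonneg _)
  rw [fst_rqErr, abs_div, abs_of_pos (h.A_pos.trans_le h1), div_le_iff₀ (h.A_pos.trans_le h1)]
  refine h2.trans ?_
  have : 0 ≤ g / 3 * r ^ 2 := by have := h.g_pos; positivity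
  nlinarith

theorem RQHyp.fst_rqErr_ne_zero (h : RQHyp d a g A₁) {Q : ι → DualNumber ℝ}
    (hQ : ∀ i, (d i).fst = 0 → Q i = 1) (hQ0 : ∀ i, (Q i).fst ≠ 0) : (rqErr d a Q).fst ≠ 0 := by
  have h1 := h.A_pos.trans_le (h.le_fst_rqDen hQ)
  rw [fst_rqErr]
  refine div_ne_zero ?_ h1.ne'
  obtain ⟨j, hj, haj⟩ := h.exists_ne
  have haj := (h.nonneg j).lt_of_ne' haj
  have hqj : 0 < (Q j).fst ^ 2 := by have := hQ0 j; positivity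
  rcases h.sign with hs | hs
  · have hdj := (hs j).lt_of_ne' hj
    refine (Finset.sum_pos' (fun i _ => ?_) ⟨j, Finset.mem_univ _, by positivity⟩).ne'
    have := hs i
    have := h.nonneg i
    positivity
  · have hdj := (hs j).lt_of_ne hj
    refine (Finset.sum_neg' (fun i _ => ?_) ⟨j, Finset.mem_univ _, ?_⟩).ne
    · exact mul_nonpos_of_nonpos_of_nonneg
        (mul_nonpos_of_nonpos_of_nonneg (hs i) (h.nonneg i)) (sq_nonneg _)
    · exact mul_neg_of_neg_of_pos (mul_neg_of_neg_of_pos hdj haj) hqj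

/-- From `|e| ≤ g / 3` and `|d i| ≥ g` it follows that `|d i - e| ≥ 2 g / 3`, so each factor is at
most 1/2. This linear rate suffices. -/
theorem RQHyp.seq_bound (h : RQHyp d a g A₁) (k : ℕ) (i : ι) :
    (rqSeq d a k i).fst ≠ 0 ∧ ((d i).fst ≠ 0 → |(rqSeq d a k i).fst| ≤ (1 / 2) ^ k) := by
  induction k generalizing i with
  | zero => simp [rqSeq_zero]
  | succ k ih =>
    rw [rqSeq_succ, rqStep]
    split_ifs with hi
    · exact ⟨(ih i).1, fun h => absurd hi h⟩
    · have hQ := fun i (hi : (d i).fst = 0) => rqSeq_of_fst_eq_zero (a := a) hi k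
      have h1 : |(rqErr d a (rqSeq d a k)).fst| ≤ g / 3 := by
        refine (h.abs_fst_rqErr_le hQ fun i hi => (ih i).2 hi).trans ?_
        have h2 : ((1 / 2 : ℝ) ^ k) ^ 2 ≤ 1 :=
          pow_le_one₀ (by positivity) (pow_le_one₀ (by norm_num) (by norm_num))
        have := h.g_pos
        nlinarith
      have h3 := h.fst_rqErr_ne_zero hQ fun i => (ih i).1
      set e := rqErr d a (rqSeq d a k) with he
      have h4 : 2 * (g / 3) ≤ |(d i).fst - e.fst| := by
        have := abs_sub_abs_le_abs_sub (d i).fst e.fst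
        linarith [h.gap i hi]
      have h5 : 0 < |(d i).fst - e.fst| := by have := h.g_pos; linarith
      have h6 : (rqSeq d a k i * (-e * (d i - e)⁻¹)).fst =
          (rqSeq d a k i).fst * (-e.fst / ((d i).fst - e.fst)) := by
        simp [div_eq_mul_inv]
      rw [h6]
      refine ⟨mul_ne_zero (ih i).1 (div_ne_zero (neg_ne_zero.2 h3) (abs_pos.1 h5)), fun _ => ?_⟩
      rw [abs_mul, abs_div, abs_neg, pow_succ]
      refine mul_le_mul ((ih i).2 hi) ?_ (by positivity) (by positivity)
      rw [div_le_iff₀ h5]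
      linarith

theorem RQHyp.err_bound (h : RQHyp d a g A₁) (k : ℕ) :
    |(rqErr d a (rqSeq d a k)).fst| ≤ g / 3 * (1 / 4) ^ k := by
  refine (h.abs_fst_rqErr_le (fun _ hi => rqSeq_of_fst_eq_zero hi k)
    fun i hi => (h.seq_bound k i).2 hi).trans_eq ?_
  rw [← pow_mul, mul_comm k 2, pow_mul]
  norm_num

theorem RQHyp.err_le (h : RQHyp d a g A₁) (k : ℕ) :
    |(rqErr d a (rqSeq d a k)).fst| ≤ g / 3 := by
  refine (h.err_bound k).trans (mul_le_of_le_one_right (by linarith [h.g_pos]) ?_)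
  exact pow_le_one₀ (by norm_num) (by norm_num)

theorem RQHyp.err_ne_zero (h : RQHyp d a g A₁) (k : ℕ) :
    (rqErr d a (rqSeq d a k)).fst ≠ 0 :=
  h.fst_rqErr_ne_zero (fun _ hi => rqSeq_of_fst_eq_zero hi k) fun i => (h.seq_bound k i).1

theorem RQHyp.le_abs_sub (h : RQHyp d a g A₁) (k : ℕ) {i : ι} (hi : (d i).fst ≠ 0) :
    2 * (g / 3) ≤ |(d i - rqErr d a (rqSeq d a k)).fst| := by
  have := abs_sub_abs_le_abs_sub (d i).fst (rqErr d a (rqSeq d a k)).fst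
  rw [TrivSqZeroExt.fst_sub]
  linarith [h.gap i hi, h.err_le k]

theorem RQHyp.sub_ne_zero (h : RQHyp d a g A₁) (k : ℕ) (i : ι) :
    (d i - rqErr d a (rqSeq d a k)).fst ≠ 0 := by
  by_cases hi : (d i).fst = 0
  · simpa [hi] using h.err_ne_zero k
  · have := h.le_abs_sub k hi
    have := h.g_pos
    exact abs_pos.1 (by linarith)

theorem RQHyp.den_pos (h : RQHyp d a g A₁) (k : ℕ) : 0 < (rqDen a (rqSeq d a k)).fst :=
  h.A_pos.trans_le (h.le_fst_rqDen fun _ hi => rqSeq_of_fst_eq_zero hi k)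

open Classical Asymptotics in
/-- The error of the Rayleigh quotient and the coordinates outside the eigenspace tend to zero, with
their dual parts. -/
theorem RQHyp.tendsto (h : RQHyp d a g A₁) :
    Tendsto (fun k => rqErr d a (rqSeq d a k)) atTop (𝓝 0) ∧
      ∀ i, Tendsto (fun k => rqSeq d a k i) atTop (𝓝 (if (d i).fst = 0 then 1 else 0)) := by
  -- No bound on the dual parts is known beforehand, so they are measured against their own total
  -- size `G = 1 + D`. The recursion then yields `D (k + 1) = o(G k)`, which forces `D` to be
  -- bounded.
  set D : ℕ → ℝ := fun k => ∑ i, |(rqSeq d a k i).snd| with hD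
  set G : ℕ → ℝ := fun k => 1 + D k with hG
  have hD0 : ∀ k, 0 ≤ D k := fun k => Finset.sum_nonneg fun _ _ => abs_nonneg _
  have h1G : (fun _ => (1 : ℝ)) =O[atTop] G :=
    IsBigO.of_bound 1 (Eventually.of_forall fun k => by
      rw [norm_one, one_mul, Real.norm_of_nonneg] <;> simp only [hG] <;> linarith [hD0 k])
  have hsnd : ∀ i, (fun k => (rqSeq d a k i).snd) =O[atTop] G := fun i =>
    IsBigO.of_bound 1 (Eventually.of_forall fun k => by
      have h2 : |(rqSeq d a k i).snd| ≤ D k :=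
        Finset.single_le_sum (f := fun i => |(rqSeq d a k i).snd|)
          (fun _ _ => abs_nonneg _) (Finset.mem_univ i)
      rw [one_mul, Real.norm_eq_abs, Real.norm_of_nonneg] <;> simp only [hG] <;> linarith [hD0 k])
  have hfst : ∀ i, (d i).fst ≠ 0 →
      (fun k => (rqSeq d a k i).fst) =o[atTop] (fun _ => (1 : ℝ)) := by
    intro i hi
    rw [isLittleO_one_iff]
    exact squeeze_zero_norm (fun k => (h.seq_bound k i).2 hi)
      (tendsto_pow_atTop_nhds_zero_of_lt_one (by norm_num) (by norm_num))
  have hQ2 : ∀ i, (d i).fst ≠ 0 → DSmall G fun k => rqSeq d a k i ^ 2 := fun i hi =>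
    DSmall.sq_of_bdd (hfst i hi) (hsnd i)
  have hQ : ∀ i, (d i).fst ≠ 0 → DBdd G fun k => rqSeq d a k i := fun i hi =>
    ⟨(hfst i hi).isBigO, hsnd i⟩
  have hnum : DSmall G fun k => ∑ i, d i * a i * rqSeq d a k i ^ 2 := by
    refine DSmall.sum _ fun i _ => ?_
    by_cases hi : (d i).fst = 0
    · simp only [h.mul_eq_zero i hi, zero_mul]
      exact ⟨by simp, by simp⟩
    · exact (DBdd.const h1G _).mul_small (hQ2 i hi)
  have hden : DBdd G fun k => rqDen a (rqSeq d a k) := by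
    refine DBdd.sum _ fun i _ => ?_
    by_cases hi : (d i).fst = 0
    · simp only [rqSeq_of_fst_eq_zero hi]
      exact DBdd.const h1G _
    · exact ((DBdd.const h1G _).mul_small (hQ2 i hi)).bdd
  have herr : DSmall G fun k => rqErr d a (rqSeq d a k) := by
    have := (hden.inv h.A_pos fun k =>
      (h.le_fst_rqDen fun _ hi => rqSeq_of_fst_eq_zero hi k).trans (le_abs_self _)).mul_small hnum
    simpa only [rqErr, mul_comm] using this
  have hnext : ∀ i, (d i).fst ≠ 0 → DSmall G fun k => rqSeq d a (k + 1) i := by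
    intro i hi
    have h1 : DBdd G fun k => d i - rqErr d a (rqSeq d a k) := by
      simpa only [sub_eq_add_neg] using (DBdd.const h1G _).add herr.neg.bdd
    have h2 := h1.inv (by have := h.g_pos; positivity) fun k => h.le_abs_sub k hi
    have h3 := (hQ i hi).mul_small (h2.mul_small herr.neg)
    simp only [rqSeq_succ, rqStep, if_neg hi]
    simpa only [mul_comm] using h3
  have hDO : D =O[atTop] (fun _ => (1 : ℝ)) := by
    refine isBigO_one_of_succ_isLittleO hD0 (IsLittleO.fun_sum fun i _ => ?_)
    by_cases hi : (d i).fst = 0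
    · simp only [rqSeq_of_fst_eq_zero hi]
      simp
    · exact (hnext i hi).2.abs_left
  have hGO : G =O[atTop] (fun _ => (1 : ℝ)) := (isBigO_refl _ _).add hDO
  refine ⟨herr.tendsto hGO, fun i => ?_⟩
  split_ifs with hi
  · simp only [rqSeq_of_fst_eq_zero hi]
    exact tendsto_const_nhds
  · exact (tendsto_add_atTop_iff_nat 1).1 ((hnext i hi).tendsto hGO)

end

section

/-! ### Local convergence of the Rayleigh quotient iteration -/

variable {n : ℕ}

theorem tendsto_dual_iff {R : Type*} [TopologicalSpace R] {α : Type*} {l : Filter α}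
    {f : α → TrivSqZeroExt R R} {z : TrivSqZeroExt R R} :
    Tendsto f l (𝓝 z) ↔ Tendsto (fun k => (f k).fst) l (𝓝 z.fst) ∧
      Tendsto (fun k => (f k).snd) l (𝓝 z.snd) := by
  refine ⟨fun h => ⟨(TrivSqZeroExt.continuous_fst.tendsto z).comp h,
    (TrivSqZeroExt.continuous_snd.tendsto z).comp h⟩, fun ⟨h1, h2⟩ => ?_⟩
  exact h1.prodMk_nhds h2

theorem continuous_ofDual : Continuous ofDual :=
  (TrivSqZeroExt.continuous_inl.comp
      (Quaternion.continuous_coe.comp TrivSqZeroExt.continuous_fst)).add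
    (TrivSqZeroExt.continuous_inr.comp
      (Quaternion.continuous_coe.comp TrivSqZeroExt.continuous_snd))

theorem tendsto_inv_dualSqrt {α : Type*} {l : Filter α} {f : α → DualNumber ℝ} {z : DualNumber ℝ}
    (hz : 0 < z.fst) (h : Tendsto f l (𝓝 z)) :
    Tendsto (fun k => (dualSqrt (f k))⁻¹) l (𝓝 (dualSqrt z)⁻¹) := by
  rw [tendsto_dual_iff] at h
  obtain ⟨h1, h2⟩ := h
  have h0 : √z.fst ≠ 0 := (Real.sqrt_pos.2 hz).ne'
  have h3 : Tendsto (fun k => √(f k).fst) l (𝓝 √z.fst) := h1.sqrt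
  rw [tendsto_dual_iff]
  simp only [dualSqrt, TrivSqZeroExt.fst_inv, TrivSqZeroExt.snd_inv, TrivSqZeroExt.fst_add,
    TrivSqZeroExt.snd_add, TrivSqZeroExt.fst_inl, TrivSqZeroExt.fst_inr, TrivSqZeroExt.snd_inl,
    TrivSqZeroExt.snd_inr, add_zero, zero_add, smul_eq_mul, MulOpposite.smul_eq_mul_unop,
    MulOpposite.unop_op]
  refine ⟨h3.inv₀ h0, ?_⟩
  have h4 := h2.div (h3.const_mul 2) (mul_ne_zero two_ne_zero h0)
  exact (((h3.inv₀ h0).mul h4).mul (h3.inv₀ h0)).neg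

theorem vnsq_colMat_mulVec {v : Fin n → Vec n} (hv : Orthonormal v) (z : Vec n) :
    vnsq (colMat v *ᵥ z) = vnsq z := by
  apply ofDual_injective
  rw [ofDual_vnsq, ofDual_vnsq, star_mulVec_dotProduct, mulVec_mulVec, orthonormal_iff.1 hv,
    one_mulVec]

variable {B : Mat n} {v : Fin n → Vec n} {σ : Fin n → DualNumber ℝ}

theorem mulVec_colMat_mulVec (hσ : ∀ k, B *ᵥ v k = fun i => v k i * ofDual (σ k)) (z : Vec n) :
    B *ᵥ (colMat v *ᵥ z) = colMat v *ᵥ fun i => ofDual (σ i) * z i := by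
  rw [mulVec_mulVec, mul_diagonal_of_eigen hσ, ← mulVec_mulVec]
  congr 1
  ext1 i
  rw [mulVec_diagonal]

theorem rayleigh_colMat_mulVec (hv : Orthonormal v)
    (hσ : ∀ k, B *ᵥ v k = fun i => v k i * ofDual (σ k)) (z : Vec n) (b : DualNumber ℝ) :
    rayleigh B (fun i => (colMat v *ᵥ z) i * ofDual b) =
      ofDual ((∑ i, σ i * nsq (z i)) * b ^ 2) := by
  have h1 : rayleigh B (colMat v *ᵥ z) = ofDual (∑ i, σ i * nsq (z i)) := by
    rw [rayleigh, mulVec_colMat_mulVec hσ, star_mulVec_dotProduct, mulVec_mulVec,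
      orthonormal_iff.1 hv, one_mulVec, dotProduct, ofDual_sum]
    refine Finset.sum_congr rfl fun i _ => ?_
    rw [ofDual_mul, ofDual_nsq, Pi.star_apply, ← mul_assoc, ← ofDual_comm, mul_assoc]
  rw [rayleigh, mulVec_mul_right, dotProduct_mul_right, star_dotProduct, dotProduct_mul_right,
    star_mul, star_ofDual, ← star_dotProduct, ← rayleigh, h1, ← ofDual_mul, ← ofDual_mul]
  congr 1
  ring

theorem isUnit_sub_smul_one (hv : Orthonormal v)
    (hσ : ∀ k, B *ᵥ v k = fun i => v k i * ofDual (σ k)) {t : DualNumber ℝ}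
    (ht : ∀ i, (σ i - t).fst ≠ 0) : IsUnit (B - ofDual t • (1 : Mat n)) := by
  refine IsUnit.of_mul_eq_one
    (colMat v * (diagonal fun i => ofDual (σ i - t)⁻¹) * (colMat v)ᴴ) ?_
  have h1 : (B - ofDual t • (1 : Mat n)) * colMat v =
      colMat v * diagonal fun i => ofDual (σ i - t) := by
    ext1 i k
    rw [Matrix.sub_mul, mul_diagonal_of_eigen hσ, Matrix.sub_apply, mul_diagonal, mul_diagonal,
      Matrix.smul_mul, Matrix.one_mul, Matrix.smul_apply, ofDual_sub, mul_sub, smul_eq_mul,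
      ofDual_comm t]
  rw [← Matrix.mul_assoc, ← Matrix.mul_assoc, h1, Matrix.mul_assoc (colMat v), diagonal_mul_diagonal]
  simp only [ofDual_mul_inv (ht _)]
  rw [diagonal_one, Matrix.mul_one, hv.mul_conjTranspose]

theorem not_isUnit_of_mulVec_eq_zero {C : Mat n} {x : Vec n} (hx : star x ⬝ᵥ x = 1)
    (h : C *ᵥ x = 0) : ¬ IsUnit C := by
  rintro ⟨C, rfl⟩
  have h1 : x = 0 := by
    rw [← one_mulVec x, ← C.inv_mul, ← mulVec_mulVec, h, mulVec_zero]
  obtain ⟨i, hi⟩ := isAppreciableVec_of_unit hx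
  exact hi (by simp [h1])

/-- The iteration stops at once when it is started at a vector whose Rayleigh quotient is an
eigenvalue. -/
theorem rqiReturns_of_rayleigh_eq {u₀ x : Vec n} {m : DualNumber ℝ} (hu : star u₀ ⬝ᵥ u₀ = 1)
    (hr : rayleigh B u₀ = ofDual m) (hx : star x ⬝ᵥ x = 1)
    (hBx : B *ᵥ x = fun i => x i * ofDual m) : RQIReturns B u₀ (ofDual m) x := by
  have h0 : shifted B u₀ *ᵥ x = 0 := by
    rw [shifted_mulVec hr, hBx]
    ext1 i
    simp
  exact ⟨norm₂_eq_one_iff.2 hu, fun _ => u₀, rfl,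
    Or.inl ⟨0, by simp, not_isUnit_of_mulVec_eq_zero hx h0, norm₂_eq_one_iff.2 hx, h0, hr.symm⟩⟩

/-- The signs of the iterates. -/
def rqSign (d a : Fin n → DualNumber ℝ) : ℕ → ℝ
  | 0 => 1
  -- The solution `w` points along `-e⁻¹` times the old direction, so normalization flips the sign
  -- exactly when `e` is positive.
  | k + 1 => if 0 < (rqErr d a (rqSeq d a k)).fst then -rqSign d a k else rqSign d a k

theorem rqSign_eq (d a : Fin n → DualNumber ℝ) (k : ℕ) :
    rqSign d a k = 1 ∨ rqSign d a k = -1 := by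
  induction k with
  | zero => exact Or.inl rfl
  | succ k ih =>
    rw [rqSign]
    split_ifs <;> rcases ih with h | h <;> simp [h]

/-- In the eigenbasis the shifted matrix is diagonal, so the iterates are explicit: `u k` is the
vector with coordinates `c i * Q k i`, divided by its norm `N k` and given the sign `t k`. -/
theorem rqiReturns_of_hyp (hv : Orthonormal v)
    (hσ : ∀ k, B *ᵥ v k = fun i => v k i * ofDual (σ k)) {c : Vec n} (hc1 : vnsq c = 1)
    {m : DualNumber ℝ} (hc : ∀ i, (σ i - m).fst = 0 → ofDual (σ i - m) * c i = 0) {g A₁ : ℝ}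
    (h : RQHyp (fun i => σ i - m) (fun i => nsq (c i)) g A₁) :
    ∃ x', RQIReturns B (colMat v *ᵥ c) (ofDual m) x' := by
  classical
  set d : Fin n → DualNumber ℝ := fun i => σ i - m with hd
  set a : Fin n → DualNumber ℝ := fun i => nsq (c i) with ha
  set Q : ℕ → Fin n → DualNumber ℝ := rqSeq d a with hQ
  set e : ℕ → DualNumber ℝ := fun k => rqErr d a (Q k) with he
  set E : ℕ → DualNumber ℝ := fun k => rqDen a (Q k) with hE
  set N : ℕ → DualNumber ℝ := fun k => dualSqrt (E k) with hN
  set t : ℕ → DualNumber ℝ := fun k => TrivSqZeroExt.inl (rqSign d a k) with ht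
  set z : ℕ → Vec n := fun k i => c i * ofDual (Q k i) with hz
  set u : ℕ → Vec n := fun k i => (colMat v *ᵥ z k) i * ofDual (t k * (N k)⁻¹) with hu
  have hEpos : ∀ k, 0 < (E k).fst := h.den_pos
  have hN2 : ∀ k, N k ^ 2 = E k := fun k => dualSqrt_sq (hEpos k)
  have hNi : ∀ k, N k * (N k)⁻¹ = 1 := fun k =>
    TrivSqZeroExt.mul_inv_cancel (fst_dualSqrt_pos (hEpos k)).ne'
  have hEi : ∀ k, E k * (E k)⁻¹ = 1 := fun k => TrivSqZeroExt.mul_inv_cancel (hEpos k).ne'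
  have hei : ∀ k, e k * (e k)⁻¹ = 1 := fun k => TrivSqZeroExt.mul_inv_cancel (h.err_ne_zero k)
  have ht2 : ∀ k, t k ^ 2 = 1 := fun k => by
    rcases rqSign_eq d a k with h1 | h1 <;> simp [ht, h1]
  have hza : ∀ k, vnsq (z k) = E k := fun k => by
    simp only [hz, vnsq, nsq_mul_ofDual, hE, rqDen, ha]
  have hθ : ∀ k, rayleigh B (u k) = ofDual (m + e k) := by
    intro k
    rw [hu, rayleigh_colMat_mulVec hv hσ]
    congr 1
    have h1 : ∑ i, σ i * nsq (z k i) = m * E k + ∑ i, d i * a i * Q k i ^ 2 := by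
      simp only [hz, nsq_mul_ofDual, hE, rqDen, Finset.mul_sum, ← Finset.sum_add_distrib, hd, ha]
      exact Finset.sum_congr rfl fun i _ => by ring
    have h2 : ((N k)⁻¹) ^ 2 = (E k)⁻¹ := by
      linear_combination (E k)⁻¹ * (N k * (N k)⁻¹ + 1) * hNi k - (N k)⁻¹ ^ 2 * (E k)⁻¹ * hN2 k
        - (N k)⁻¹ ^ 2 * hEi k
    have h3 : e k = (∑ i, d i * a i * Q k i ^ 2) * (E k)⁻¹ := rfl
    rw [h1, h3, mul_pow, ht2, h2]
    linear_combination m * hEi k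
  have hstep : ∀ k, IsRQIStep B (u k) (u (k + 1)) := by
    intro k
    refine ⟨?_, fun i => (colMat v *ᵥ z (k + 1)) i * ofDual (-(e k)⁻¹ * (t k * (N k)⁻¹)), ?_, ?_⟩
    · rw [shifted, hθ]
      refine isUnit_sub_smul_one hv hσ fun i => ?_
      have h1 := h.sub_ne_zero k i
      rw [← sub_sub]
      exact h1
    · have h1 : (fun i => (B *ᵥ (colMat v *ᵥ z (k + 1))) i -
          (colMat v *ᵥ z (k + 1)) i * ofDual (m + e k)) =
          fun i => (colMat v *ᵥ z k) i * ofDual (-e k) := by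
        rw [mulVec_colMat_mulVec hσ, ← mulVec_mul_right (colMat v) (z k)]
        change _ - (fun i => (colMat v *ᵥ z (k + 1)) i * ofDual (m + e k)) = _
        rw [← mulVec_mul_right, ← mulVec_sub]
        congr 1
        ext1 i
        rw [Pi.sub_apply, ← ofDual_comm, ← sub_mul, ← ofDual_sub, ← sub_sub]
        have hQs : Q (k + 1) i = rqStep d a (Q k) i := congrFun (rqSeq_succ k) i
        by_cases hi : (d i).fst = 0
        · have hQ1 : Q (k + 1) i = Q k i := by rw [hQs, rqStep, if_pos hi]
          have h2 : ofDual (σ i - m) * z k i = 0 := by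
            simp only [hz, ← mul_assoc]
            rw [hc i hi, zero_mul]
          have hz1 : z (k + 1) i = z k i := by simp only [hz, hQ1]
          rw [hz1, ofDual_sub, sub_mul, h2, zero_sub, ofDual_comm, ofDual_neg, mul_neg]
        · have hQ1 : Q (k + 1) i = Q k i * (-e k * (d i - e k)⁻¹) := by
            rw [hQs, rqStep, if_neg hi]
          have hde : (d i - e k) * (d i - e k)⁻¹ = 1 :=
            TrivSqZeroExt.mul_inv_cancel (h.sub_ne_zero k i)
          have hz1 : z (k + 1) i = z k i * ofDual (-e k * (d i - e k)⁻¹) := by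
            simp only [hz, hQ1, ofDual_mul, mul_assoc]
          rw [hz1, ofDual_comm, mul_assoc, ← ofDual_mul]
          congr 2
          linear_combination (-e k) * hde
      rw [shifted_mulVec (hθ k), mulVec_mul_right]
      ext1 i
      have h2 := congrFun h1 i
      simp only at h2 ⊢
      rw [mul_assoc _ _ (ofDual (m + e k)), ← ofDual_comm (m + e k), ← mul_assoc _ _ (ofDual _),
        ← sub_mul, h2, mul_assoc, ← ofDual_mul]
      simp only [hu]
      congr 2
      linear_combination t k * (N k)⁻¹ * hei k
    · obtain ⟨s, hs, hs2, hse, hts⟩ : ∃ s : DualNumber ℝ, (s = 1 ∨ s = -1) ∧ s ^ 2 = 1 ∧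
          0 < (s * (e k)⁻¹).fst ∧ t (k + 1) = -t k * s := by
        have hne := h.err_ne_zero k
        by_cases hp : 0 < (e k).fst
        · refine ⟨1, Or.inl rfl, one_pow 2, by simpa using hp, ?_⟩
          simp only [ht, rqSign]
          rw [if_pos hp, mul_one, TrivSqZeroExt.inl_neg]
        · refine ⟨-1, Or.inr rfl, by ring, ?_, ?_⟩
          · have : (e k).fst < 0 := lt_of_le_of_ne (not_lt.1 hp) hne
            simpa using this
          · simp only [ht, rqSign]
            rw [if_neg hp]
            ring
      have hNpos := fst_dualSqrt_pos (hEpos k)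
      have hNpos' := fst_dualSqrt_pos (hEpos (k + 1))
      -- This is the norm of `w`; `s` is the sign of `e k`, chosen to make `b` positive.
      set b := s * (e k)⁻¹ * (N k)⁻¹ * N (k + 1) with hb
      have hbpos : 0 < b.fst := by
        rw [hb, TrivSqZeroExt.fst_mul, TrivSqZeroExt.fst_mul, TrivSqZeroExt.fst_inv]
        exact mul_pos (mul_pos hse (inv_pos.2 hNpos)) hNpos'
      have hnorm := norm₂_eq_of_sq
        (x := fun i => (colMat v *ᵥ z (k + 1)) i * ofDual (-(e k)⁻¹ * (t k * (N k)⁻¹))) hbpos (by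
          rw [vnsq_mul_ofDual, vnsq_colMat_mulVec hv, hza, hb]
          linear_combination (e k)⁻¹ ^ 2 * (N k)⁻¹ ^ 2 * N (k + 1) ^ 2 * hs2 +
            (e k)⁻¹ ^ 2 * (N k)⁻¹ ^ 2 * hN2 (k + 1) -
            (e k)⁻¹ ^ 2 * (N k)⁻¹ ^ 2 * E (k + 1) * ht2 k)
      rw [hnorm]
      ext1 i
      have hbi : b * b⁻¹ = 1 := TrivSqZeroExt.mul_inv_cancel hbpos.ne'
      simp only [hu]
      rw [mul_assoc, ← ofDual_mul]
      congr 2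
      rw [hts]
      have h5 : -t k * s * b = -(e k)⁻¹ * (t k * (N k)⁻¹) * N (k + 1) := by
        rw [hb]
        linear_combination (-t k * (e k)⁻¹ * (N k)⁻¹ * N (k + 1)) * hs2
      linear_combination (N (k + 1))⁻¹ * b⁻¹ * h5 + t k * s * (N (k + 1))⁻¹ * hbi -
        (e k)⁻¹ * (t k * (N k)⁻¹) * b⁻¹ * hNi (k + 1)
  obtain ⟨helim, hQlim⟩ := h.tendsto
  have hQi : Tendsto Q atTop (𝓝 fun i => if (d i).fst = 0 then 1 else 0) :=
    tendsto_pi_nhds.2 hQlim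
  set Q' : Fin n → DualNumber ℝ := fun i => if (d i).fst = 0 then 1 else 0 with hQ'
  have hElim : Tendsto E atTop (𝓝 (rqDen a Q')) :=
    tendsto_finsetSum _ fun i _ => (hQlim i).pow 2 |>.const_mul _
  have hE' : 0 < (rqDen a Q').fst :=
    h.A_pos.trans_le (h.le_fst_rqDen fun i hi => if_pos hi)
  have hNlim := tendsto_inv_dualSqrt hE' hElim
  -- The limit keeps the coordinates of the start whose eigenvalue has the standard part of `m`,
  -- normalized. It depends on the start and need not be the given eigenvector.
  refine ⟨fun i => (colMat v *ᵥ fun i => c i * ofDual (Q' i)) i * ofDual (dualSqrt (rqDen a Q'))⁻¹,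
    ?_⟩
  refine ⟨?_, u, ?_, Or.inr ⟨hstep, ?_, rqSign d a, rqSign_eq d a, ?_⟩⟩
  · rw [norm₂_eq_one_iff, ← ofDual_vnsq, vnsq_colMat_mulVec hv, hc1, ofDual_one]
  · have h0 : z 0 = c := by
      ext1 i
      simp [hz, hQ, rqSeq_zero]
    have h1 : N 0 = 1 := by
      refine dual_eq_of_sq_eq (fst_dualSqrt_pos (hEpos 0)) (by simp) ?_
      rw [hN2, ← hza, h0, hc1, one_pow]
    ext1 i
    simp [hu, h0, h1, ht, rqSign]
  · have h1 : Tendsto (fun k => m + e k) atTop (𝓝 (m + 0)) := helim.const_add m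
    rw [add_zero] at h1
    simp only [hθ]
    exact (continuous_ofDual.tendsto m).comp h1
  · have h1 : (fun k => rqSign d a k • u k) =
        fun k i => (colMat v *ᵥ z k) i * ofDual (N k)⁻¹ := by
      ext1 k
      ext1 i
      rw [Pi.smul_apply, real_smul_eq]
      simp only [hu]
      rw [mul_assoc, ← ofDual_mul]
      congr 2
      have := ht2 k
      simp only [ht] at this ⊢
      linear_combination (N k)⁻¹ * this
    rw [h1, tendsto_pi_nhds]
    intro i
    refine Tendsto.mul ?_ ((continuous_ofDual.tendsto _).comp hNlim)
    have h2 : Tendsto (fun k => ∑ j, colMat v i j * (c j * ofDual (Q k j))) atTop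
        (𝓝 (∑ j, colMat v i j * (c j * ofDual (Q' j)))) :=
      tendsto_finsetSum _ fun j _ =>
        (((continuous_ofDual.tendsto _).comp (hQlim j)).const_mul _).const_mul _
    exact h2

end

/-! ### Neighbourhoods of a dominant eigenvector, and existence of a stopping run. -/

section

variable {n : ℕ}

theorem exists_gap {ι : Type*} [Finite ι] (f : ι → ℝ) :
    ∃ g > 0, ∀ i, f i ≠ 0 → g ≤ |f i| := by
  have h1 : ∀ᶠ g in 𝓝[>] (0 : ℝ), ∀ i, f i ≠ 0 → g ≤ |f i| := by
    rw [eventually_all]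
    intro i
    by_cases hi : f i = 0
    · simp [hi]
    · have := eventually_nhdsWithin_of_eventually_nhds (s := Set.Ioi 0)
        (eventually_le_nhds (abs_pos.2 hi))
      filter_upwards [this] with g hg _ using hg
  obtain ⟨g, hg, hg0⟩ := (h1.and self_mem_nhdsWithin).exists
  exact ⟨g, hg0, hg⟩

variable {B : Mat n} {v : Fin n → Vec n} {σ : Fin n → DualNumber ℝ}

/-- Local convergence: the Rayleigh quotient iteration returns the extremal eigenvalue `m` from
every unit vector near an eigenvector that has no infinitesimal coupling to the other eigenvalues
with the same standard part. -/
theorem exists_pos_rqiReturns (hB : B.IsHermitian) (hv : Orthonormal v)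
    (hσ : ∀ k, B *ᵥ v k = fun i => v k i * ofDual (σ k)) {m : DualNumber ℝ} {x : Vec n}
    (hx : star x ⬝ᵥ x = 1) (hBx : B *ᵥ x = fun i => x i * ofDual m)
    (hmax : ∀ i, |(σ i).fst| ≤ |m.fst|) :
    ∃ δ > 0, ∀ u₀ : Vec n, star u₀ ⬝ᵥ u₀ = 1 → (∀ i, ‖(u₀ i).fst - (x i).fst‖ < δ) →
      (∀ i, σ i ≠ m → (σ i).fst = m.fst → (star (v i) ⬝ᵥ u₀).fst = 0) →
      ∃ x', RQIReturns B u₀ (ofDual m) x' := by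
  classical
  set d : Fin n → DualNumber ℝ := fun i => σ i - m with hd
  obtain ⟨g, hg0, hg⟩ := exists_gap fun i => (d i).fst
  -- Since the squared coordinates sum to 1, the weighted sum equals `∑ |d i| a i + (g / 3) (1 -
  -- A₁)`. Making it smaller than `g / 3` gives both `small` and `A₁ > 0`.
  set wt : Fin n → ℝ := fun i => if (d i).fst = 0 then 0 else |(d i).fst| + g / 3 with hwt
  set F : (Fin n → ℍ[ℝ]) → ℝ := fun y => ∑ i, wt i * ‖∑ j, star (v i j).fst * y j‖ ^ 2 with hF
  have hFc : Continuous F := by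
    refine continuous_finsetSum _ fun i _ => continuous_const.mul (Continuous.pow ?_ 2)
    exact (continuous_finsetSum _ fun j _ => continuous_const.mul (continuous_apply j)).norm
  have hcoord : ∀ (y : Vec n) i, ∑ j, star (v i j).fst * (y j).fst = (star (v i) ⬝ᵥ y).fst := by
    intro y i
    simp [dotProduct, TrivSqZeroExt.fst_sum]
  have hFx : F (fun j => (x j).fst) = 0 := by
    refine Finset.sum_eq_zero fun i _ => ?_
    rw [hcoord, hwt]
    by_cases hi : (d i).fst = 0
    · simp [hi]
    · have : star (v i) ⬝ᵥ x = 0 := dotProduct_eq_zero_of_fst_ne hB hBx (hσ i) (by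
        intro hc
        exact hi (by simp [hd, hc]))
      simp [this]
  obtain ⟨δ, hδ, hδF⟩ := Metric.continuousAt_iff.1 (hFc.continuousAt (x := fun j => (x j).fst))
    (g / 3) (by positivity)
  refine ⟨δ, hδ, fun u₀ hu hux hort => ?_⟩
  set c : Vec n := (colMat v)ᴴ *ᵥ u₀ with hc
  have hcu : colMat v *ᵥ c = u₀ := hv.expand u₀
  have hc1 : vnsq c = 1 := by
    apply ofDual_injective
    rw [← vnsq_colMat_mulVec hv, hcu, ofDual_vnsq, hu, ofDual_one]
  -- For `σ i ≠ m` with the same standard part, the orthogonality condition on the start makes `c i`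
  -- infinitesimal, and a product of two infinitesimals is zero.
  have hc0 : ∀ i, (d i).fst = 0 → ofDual (d i) * c i = 0 := by
    intro i hi
    by_cases hm : σ i = m
    · simp [hd, hm]
    · have h1 : (σ i).fst = m.fst := by simpa [hd, sub_eq_zero] using hi
      exact mul_eq_zero_of_fst_eq_zero (by simp [hi]) (hort i hm h1)
  set a : Fin n → DualNumber ℝ := fun i => nsq (c i) with ha
  have hda : ∀ i, (d i).fst = 0 → d i * a i = 0 := by
    intro i hi
    apply ofDual_injective
    rw [ofDual_mul, ofDual_nsq, ← mul_assoc, ofDual_comm, mul_assoc, hc0 i hi, mul_zero,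
      ofDual_zero]
  have ha0 : ∀ i, 0 ≤ (a i).fst := fun i => by simp only [ha, fst_nsq]; positivity
  by_cases hex : ∃ i, (d i).fst ≠ 0 ∧ (a i).fst ≠ 0
  · have hsmall : ∑ i, wt i * (a i).fst < g / 3 := by
      have h1 : dist (F fun j => (u₀ j).fst) (F fun j => (x j).fst) < g / 3 := by
        refine hδF ((dist_pi_lt_iff hδ).2 fun i => ?_)
        rw [dist_eq_norm]
        exact hux i
      rw [hFx, Real.dist_eq, sub_zero] at h1
      refine (le_of_eq ?_).trans_lt ((le_abs_self _).trans_lt h1)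
      refine Finset.sum_congr rfl fun i _ => ?_
      rw [hcoord, ha, fst_nsq]
      rfl
    have hsum : ∑ i, (a i).fst = 1 := by
      have := congrArg TrivSqZeroExt.fst hc1
      rwa [vnsq, TrivSqZeroExt.fst_sum, TrivSqZeroExt.fst_one] at this
    set A₁ : ℝ := ∑ i, if (d i).fst = 0 then (a i).fst else 0 with hA₁
    have hsplit : ∑ i, wt i * (a i).fst =
        ∑ i, |(d i).fst| * (a i).fst + g / 3 * (1 - A₁) := by
      rw [← hsum, hA₁, ← Finset.sum_sub_distrib, Finset.mul_sum, ← Finset.sum_add_distrib]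
      refine Finset.sum_congr rfl fun i _ => ?_
      simp only [hwt]
      split_ifs with hi
      · simp [hi]
      · ring
    have hnn : 0 ≤ ∑ i, |(d i).fst| * (a i).fst :=
      Finset.sum_nonneg fun i _ => mul_nonneg (abs_nonneg _) (ha0 i)
    have hyp : RQHyp d a g A₁ :=
      { nonneg := ha0
        mul_eq_zero := hda
        g_pos := hg0
        gap := hg
        A_pos := by
          by_contra hneg
          nlinarith
        A_eq := hA₁
        small := by linarith
        sign := by
          rcases le_total 0 m.fst with hm | hm
          · right
            intro i
            have := (le_abs_self _).trans (hmax i)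
            rw [abs_of_nonneg hm] at this
            simpa [hd] using this
          · left
            intro i
            have := (neg_abs_le _).trans' (neg_le_neg (hmax i))
            rw [abs_of_nonpos hm, neg_neg] at this
            simpa [hd] using this
        exists_ne := hex }
    rw [← hcu]
    exact rqiReturns_of_hyp hv hσ hc1 hc0 hyp
  -- With no appreciable coordinate outside the eigenspace, the Rayleigh quotient is exactly `m` and
  -- the iteration stops at once.
  · push Not at hex
    have hda' : ∀ i, d i * a i = 0 := by
      intro i
      by_cases hi : (d i).fst = 0
      · exact hda i hi
      · have h1 := hex i hi
        have h2 : (c i).fst = 0 := by simpa [ha] using h1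
        rw [ha]
        simp [nsq_eq_zero h2]
    refine ⟨x, rqiReturns_of_rayleigh_eq hu ?_ hx hBx⟩
    have h1 := rayleigh_colMat_mulVec hv hσ c 1
    simp only [ofDual_one, mul_one, one_pow] at h1
    rw [← hcu]
    refine h1.trans (congrArg ofDual ?_)
    have h2 : ∀ i, σ i * nsq (c i) = m * nsq (c i) := fun i => by
      have := hda' i
      simp only [hd, ha, sub_mul] at this
      exact sub_eq_zero.1 this
    simp only [h2, ← Finset.mul_sum]
    rw [← vnsq, hc1, mul_one]

/-- A Hermitian matrix with nonzero standard part has an appreciable eigenvalue in every spectral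
decomposition. -/
theorem exists_fst_ne_zero (hv : Orthonormal v)
    (hσ : ∀ k, B *ᵥ v k = fun i => v k i * ofDual (σ k)) {γ : ℝ} (hγ : 0 ≤ γ)
    (h : γ < frobSt B) : ∃ k, (σ k).fst ≠ 0 := by
  by_contra! hc
  have := frobSt_eq_zero_iff.2 (fst_eq_zero_of_forall hv hσ hc)
  linarith

theorem exists_dominantPair (hB : B.IsHermitian) (hn : 0 < n) :
    ∃ μ x, IsDominantPair B μ x := by
  obtain ⟨v, σ, hv, hσ⟩ := exists_spectral hB
  have : Nonempty (Fin n) := ⟨⟨0, hn⟩⟩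
  obtain ⟨k, hk⟩ := Finite.exists_max fun k => |(σ k).fst|
  refine ⟨ofDual (σ k), v k, norm₂_eq_one_iff.2 (by rw [hv k k, if_pos rfl]),
    hv.isEigenvalue hσ k, fun ν hν => ?_⟩
  obtain ⟨j, rfl⟩ := eigenvalue_mem hB hv hσ hν
  rw [norm_fst_ofDual, norm_fst_ofDual]
  exact hk j

theorem IsDominantPair.rqiReturns (hB : B.IsHermitian) {γ : ℝ} (hγ : 0 ≤ γ) (h : γ < frobSt B)
    {μ : DQ} {x : Vec n} (hμ : IsDominantPair B μ x) :
    IsAppreciable μ ∧ ∃ δ > 0, ∀ u₀ : Vec n, norm₂ u₀ = 1 →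
      (∀ i, ‖(u₀ i).fst - (x i).fst‖ < δ) →
      (∀ ν y, IsEigenpair B ν y → ν ≠ μ → ν.fst = μ.fst → (innerDQ u₀ y).fst = 0) →
      ∃ x', RQIReturns B u₀ μ x' := by
  obtain ⟨v, σ, hv, hσ⟩ := exists_spectral hB
  obtain ⟨hx, hBx, hmax⟩ := hμ
  obtain ⟨m, rfl⟩ := hBx.exists_ofDual hB
  have hmax' : ∀ i, |(σ i).fst| ≤ |m.fst| := fun i => by
    have := hmax _ ⟨_, hv.isEigenvalue hσ i⟩
    rwa [norm_fst_ofDual, norm_fst_ofDual] at this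
  obtain ⟨k, hk⟩ := exists_fst_ne_zero hv hσ hγ h
  refine ⟨isAppreciable_ofDual.2 (abs_pos.1 ((abs_pos.2 hk).trans_le (hmax' k))), ?_⟩
  obtain ⟨δ, hδ, hδu⟩ := exists_pos_rqiReturns hB hv hσ (norm₂_eq_one_iff.1 hx) hBx.2 hmax'
  refine ⟨δ, hδ, fun u₀ hu hux hort => hδu u₀ (norm₂_eq_one_iff.1 hu) hux fun i hi hi' => ?_⟩
  exact hort _ _ (hv.isEigenvalue hσ i) (fun hc => hi (ofDual_injective hc)) (by simp [hi'])

theorem rqiReturns_of_eigen {a : DualNumber ℝ} {x : Vec n} (hx : star x ⬝ᵥ x = 1)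
    (hBx : B *ᵥ x = fun i => x i * ofDual a) : RQIReturns B x (ofDual a) x := by
  refine rqiReturns_of_rayleigh_eq hx ?_ hx hBx
  rw [rayleigh, hBx, dotProduct_mul_right, hx, one_mul]

theorem deflate_congr {A : Mat n} {lam lam' : ℕ → DQ} {u u' : ℕ → Vec n} {K : ℕ}
    (h : ∀ k < K, lam k = lam' k ∧ u k = u' k) : deflate A lam u K = deflate A lam' u' K := by
  induction K with
  | zero => rfl
  | succ k ih =>
    rw [deflate, deflate, ih fun j hj => h j (by omega), (h k (by omega)).1, (h k (by omega)).2]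

theorem IsRun.extend {A : Mat n} {γ : ℝ} {K : ℕ} {lam : ℕ → DQ} {u : ℕ → Vec n}
    (h : IsRun A γ K lam u) {a : DualNumber ℝ} {x : Vec n} (hx : star x ⬝ᵥ x = 1)
    (hBx : deflate A lam u K *ᵥ x = fun i => x i * ofDual a)
    (hK : 0 < K → γ < frobSt (deflate A lam u K)) :
    IsRun A γ (K + 1) (Function.update lam K (ofDual a)) (Function.update u K x) := by
  have hd : ∀ k ≤ K, deflate A (Function.update lam K (ofDual a)) (Function.update u K x) k =
      deflate A lam u k := fun k hk => deflate_congr fun j hj => by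
    rw [Function.update_of_ne (by omega), Function.update_of_ne (by omega)]
    exact ⟨rfl, rfl⟩
  refine ⟨fun k hk => ?_, fun k hk hk0 => ?_⟩
  · rw [hd k (by omega)]
    rcases Nat.lt_succ_iff_lt_or_eq.1 hk with hk | rfl
    · rw [Function.update_of_ne hk.ne, Function.update_of_ne hk.ne]
      exact h.1 k hk
    · rw [Function.update_self, Function.update_self]
      exact ⟨x, rqiReturns_of_eigen hx hBx⟩
  · rw [hd k (by omega)]
    rcases Nat.lt_succ_iff_lt_or_eq.1 hk with hk | rfl
    · exact h.2 k hk hk0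
    · exact hK hk0

/-- Started at a unit eigenvector, the iteration returns it immediately, so each round can split off
an appreciable pair while the norm exceeds `γ`. Going on for `n + 1` rounds would contradict the
bound on orthonormal families. -/
theorem exists_stopsWith {A : Mat n} (hA : A.IsHermitian) (hn : 0 < n) {γ : ℝ} (hγ : 0 ≤ γ) :
    ∃ (K : ℕ) (lam : ℕ → DQ) (u : ℕ → Vec n), K ≤ n ∧ StopsWith A γ K lam u ∧
      ((∃ μ, IsAppreciable μ ∧ IsEigenvalue A μ) → ∀ k < K, IsAppreciable (lam k)) := by
  obtain ⟨v, σ, hv, hσ⟩ := exists_spectral hA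
  have hrun0 : IsRun A γ 0 0 0 := ⟨by simp, by simp⟩
  have hvk : ∀ k, star (v k) ⬝ᵥ v k = 1 := fun k => by rw [hv k k, if_pos rfl]
  by_cases happ : ∃ μ, IsAppreciable μ ∧ IsEigenvalue A μ
  · obtain ⟨μ, hμ, hμA⟩ := happ
    obtain ⟨k₀, rfl⟩ := eigenvalue_mem hA hv hσ hμA
    by_contra! hc
    have hall : ∀ K, ∃ (lam : ℕ → DQ) (u : ℕ → Vec n), IsRun A γ (K + 1) lam u ∧
        ∀ k < K + 1, IsAppreciable (lam k) := by
      intro K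
      induction K with
      | zero =>
        refine ⟨_, _, hrun0.extend (hvk k₀) (hσ k₀) (by simp), fun k hk => ?_⟩
        obtain rfl : k = 0 := by omega
        rwa [Function.update_self]
      | succ K ih =>
        obtain ⟨lam, u, hrun, hl⟩ := ih
        obtain ⟨a, ha⟩ := hrun.exists_isDeflation hA
        have hKn : K + 1 ≤ n := by
          have h1 := ha.ncard_le hA
          have h2 : {k | k < K + 1 ∧ IsAppreciable (lam k)} = Set.Iio (K + 1) := by
            ext k
            exact ⟨fun h => h.1, fun h => ⟨h, hl k h⟩⟩
          rwa [h2, Set.ncard_Iio_nat] at h1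
        have hfro : γ < frobSt (deflate A lam u (K + 1)) := by
          by_contra hle
          obtain ⟨-, k, hk, hk'⟩ := hc (K + 1) lam u hKn ⟨hrun, by omega, not_lt.1 hle⟩
          exact hk' (hl k hk)
        obtain ⟨v', σ', hv', hσ'⟩ := exists_spectral (ha.isHermitian hA le_rfl)
        obtain ⟨j, hj⟩ := exists_fst_ne_zero hv' hσ' hγ hfro
        refine ⟨_, _, hrun.extend (a := σ' j) (x := v' j) (by rw [hv' j j, if_pos rfl]) (hσ' j)
          fun _ => hfro, fun k hk => ?_⟩
        rcases Nat.lt_succ_iff_lt_or_eq.1 hk with hk | rfl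
        · rw [Function.update_of_ne hk.ne]
          exact hl k hk
        · rw [Function.update_self]
          exact isAppreciable_ofDual.2 hj
    obtain ⟨lam, u, hrun, hl⟩ := hall n
    obtain ⟨a, ha⟩ := hrun.exists_isDeflation hA
    have h1 := ha.ncard_le hA
    have h2 : {k | k < n + 1 ∧ IsAppreciable (lam k)} = Set.Iio (n + 1) := by
      ext k
      exact ⟨fun h => h.1, fun h => ⟨h, hl k h⟩⟩
    rw [h2, Set.ncard_Iio_nat] at h1
    omega
  · have hσ0 : ∀ k, (σ k).fst = 0 := fun k => by
      by_contra hk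
      exact happ ⟨_, isAppreciable_ofDual.2 hk, _, hv.isEigenvalue hσ k⟩
    have hA0 := fst_eq_zero_of_forall hv hσ hσ0
    -- The stopping test comes only after a round, so one round with an infinitesimal eigenvalue is
    -- spent although the standard part is already 0.
    refine ⟨1, _, _, hn, ⟨hrun0.extend (hvk ⟨0, hn⟩) (hσ ⟨0, hn⟩) (by simp), one_pos, ?_⟩,
      fun h => absurd h happ⟩
    refine (frobSt_eq_zero_iff.2 fun i j => ?_).trans_le hγ
    simp [deflate, hA0, hσ0]

end

end DualQuat

end

theorem mainTheorem4 {n : ℕ} (hn : 0 < n) (A : DualQuat.Mat n) (hA : A.IsHermitian)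
    (γ : ℝ) (hγ0 : 0 ≤ γ)
    (hγ : ∀ μ, DualQuat.IsAppreciable μ → DualQuat.IsEigenvalue A μ → γ < ‖μ.fst‖) :
    -- every run that stops has returned all appreciable eigenvalues, with eigenvectors
    (∀ (K : ℕ) (lam : ℕ → DualQuat.DQ) (u : ℕ → DualQuat.Vec n),
      DualQuat.StopsWith A γ K lam u →
        (∀ k < K, DualQuat.IsAppreciable (lam k) →
          (∃ a : DualNumber ℝ, lam k = DualQuat.ofDual a) ∧
          DualQuat.norm₂ (u k) = 1 ∧ DualQuat.IsEigenpair A (lam k) (u k)) ∧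
        (∀ j < K, ∀ k < K, j ≠ k → DualQuat.IsAppreciable (lam j) →
          DualQuat.IsAppreciable (lam k) → DualQuat.innerDQ (u j) (u k) = 0) ∧
        (∀ μ, DualQuat.IsAppreciable μ → DualQuat.IsEigenvalue A μ → ∃ k < K, lam k = μ) ∧
        -- counted with multiplicity: they are the appreciable part of a unitary decomposition
        ∃ (U : DualQuat.Mat n) (σ : Fin n → DualNumber ℝ),
          Uᴴ * U = 1 ∧ Uᴴ * A * U = Matrix.diagonal (fun i => DualQuat.ofDual (σ i)) ∧
          ∃ e : {k : ℕ // k < K ∧ DualQuat.IsAppreciable (lam k)} ≃ {i : Fin n // (σ i).fst ≠ 0},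
            ∀ k, lam k.1 = DualQuat.ofDual (σ (e k).1) ∧ ∀ i, U i (e k).1 = u k.1 i) ∧
    -- as long as the procedure has not stopped, proper starting vectors for the next round exist:
    -- near any dominant eigenvector the Rayleigh quotient iteration converges
    (∀ (K : ℕ) (lam : ℕ → DualQuat.DQ) (u : ℕ → DualQuat.Vec n),
      DualQuat.IsRun A γ K lam u → γ < DualQuat.frobSt (DualQuat.deflate A lam u K) →
        (∃ μ x, DualQuat.IsDominantPair (DualQuat.deflate A lam u K) μ x) ∧
        ∀ μ x, DualQuat.IsDominantPair (DualQuat.deflate A lam u K) μ x →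
          DualQuat.IsAppreciable μ ∧
          ∃ δ > 0, ∀ u₀ : DualQuat.Vec n, DualQuat.norm₂ u₀ = 1 →
            (∀ i, ‖(u₀ i).fst - (x i).fst‖ < δ) →
            (∀ ν y, DualQuat.IsEigenpair (DualQuat.deflate A lam u K) ν y →
              ν ≠ μ → ν.fst = μ.fst → (DualQuat.innerDQ u₀ y).fst = 0) →
            ∃ x', DualQuat.RQIReturns (DualQuat.deflate A lam u K) u₀ μ x') ∧
    -- at most `n` rounds of any run return an appreciable eigenvalue
    (∀ (K : ℕ) (lam : ℕ → DualQuat.DQ) (u : ℕ → DualQuat.Vec n),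
      DualQuat.IsRun A γ K lam u → {k | k < K ∧ DualQuat.IsAppreciable (lam k)}.ncard ≤ n) ∧
    -- some run stops after at most `n` rounds, all returning appreciable eigenvalues if there are any
    (∃ (K : ℕ) (lam : ℕ → DualQuat.DQ) (u : ℕ → DualQuat.Vec n), K ≤ n ∧
      DualQuat.StopsWith A γ K lam u ∧
      ((∃ μ, DualQuat.IsAppreciable μ ∧ DualQuat.IsEigenvalue A μ) →
        ∀ k < K, DualQuat.IsAppreciable (lam k))) := by
  open DualQuat in
  refine ⟨fun K lam u h => ?_, fun K lam u h hfro => ?_, fun K lam u h => ?_,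
    exists_stopsWith hA hn hγ0⟩
  · obtain ⟨a, ha⟩ := h.1.exists_isDeflation hA
    obtain ⟨v, σ, hv, hσ, e, he⟩ := ha.exists_unitary hA (ha.fst_eq_zero hA hγ h.2.2)
    refine ⟨fun k hk hak => ?_, fun j hj k hk hjk haj hak => ?_, fun μ hμ hμA => ?_,
      colMat v, σ, orthonormal_iff.1 hv, ?_, e, fun k => ⟨(he k).1, fun i => ?_⟩⟩
    · rw [(ha k hk).1]
      exact ⟨⟨_, rfl⟩, norm₂_eq_one_iff.2 (ha k hk).2.1,
        isEigenpair_of_unit (ha k hk).2.1 (ha.eigen hA hk hak)⟩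
    -- The indices are exchanged because `innerDQ x y` is `y* x`.
    · exact ha.dotProduct_eq_zero hA hk hj hjk.symm hak haj
    · obtain ⟨i, rfl⟩ := eigenvalue_mem hA hv hσ hμA
      obtain ⟨k, hk⟩ := e.surjective ⟨i, isAppreciable_ofDual.1 hμ⟩
      refine ⟨k, k.2.1, ?_⟩
      rw [(he k).1, hk]
    · rw [Matrix.mul_assoc, mul_diagonal_of_eigen hσ, ← Matrix.mul_assoc, orthonormal_iff.1 hv,
        Matrix.one_mul]
    · rw [colMat_apply, (he k).2]
  · obtain ⟨a, ha⟩ := h.exists_isDeflation hA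
    have hB := ha.isHermitian hA le_rfl
    exact ⟨exists_dominantPair hB hn, fun μ x hμ => hμ.rqiReturns hB hγ0 hfro⟩
  · obtain ⟨a, ha⟩ := h.exists_isDeflation hA
    exact ha.ncard_le hA
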